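/- Let $k$ be a field, let $A$ be an associative unital $k$-algebra, let $B\subset A$ be a subalgebra, and let $X$ be an $A$-bimodule (on which $k$ acts centrally). Write $A^e=A\otimes_k A^{op}$, so that $A$-bimodules are $A^e$-modules; a $B$-bimodule is flat if it is flat as a $B^e$-module. For an algebra $\Lambda$ and a $\Lambda$-bimodule $X$ let $H_*(\Lambda,X)$ be the Hochschild homology, that is the homology of $X\otimes_{\Lambda^e}\mathrm{Bar}_*(\Lambda)\cong X\otimes_k\Lambda^{\otimes *}$, where $\mathrm{Bar}_n(\Lambda)=\Lambda\otimes\Lambda^{\otimes n}\otimes\Lambda$ is the bar resolution. An $A$-bimodule is relative projective if it has the lifting property for all maps of $A$-bimodules that split as maps of $B$-bimodules; a relative projective resolution $P_*\to A$ is an augmented complex of $A$-bimodules with all $P_n$ relative projective which has a contracting homotopy of $B$-bimodules. The relative Hochschild homology is $H_*(A|B,X)=\mathrm{Tor}_*^{A^e|B^e}(X,A)=H_*(X\otimes_{A^e}P_*)$; such resolutions exist. Let $I:H_m(B,X)\to H_m(A,X)$ be induced by the inclusion $B\subset A$, and let $K:H_m(A,X)\to H_m(A|B,X)$ be induced by a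 chain map of $A$-bimodules $\mathrm{Bar}_*(A)\to P_*$ lifting the identity of $A$; such chain maps exist. Assume that $A/B$ is a flat $B$-bimodule. Then, for every relative projective resolution $P_*$ of $A$ and every such chain map, there are linear maps $\delta:H_{m+1}(A|B,X)\to H_m(B,X)$ such that the Jacobi-Zariski sequence $$\cdots\xrightarrow{\delta} H_m(B,X)\xrightarrow{I}H_m(A,X)\xrightarrow{K}H_m(A|B,X)\xrightarrow{\delta}H_{m-1}(B,X)\xrightarrow{I}\cdots\xrightarrow{\delta}H_2(B,X)\xrightarrow{I}H_2(A,X)\xrightarrow{K}H_2(A|B,X)$$ is exact: at $H_m(B,X)$ and at $H_m(A,X)$ for all $m\ge 2$, and at $H_m(A|B,X)$ for all $m\geq 3$. If moreover $A$ and $X$ are finite dimensional over $k$, the sequence is exact down to degree $1$: with the same maps, $$\cdots\xrightarrow{\delta} H_m(B,X)\xrightarrow{I}H_m(A,X)\xrightarrow{K}H_m(A|B,X)\xrightarrow{\delta}\cdots\xrightarrow{\delta}H_1(B,X)\xrightarrow{I}H_1(A,X)\xrightarrow{K}H_1(A|B,X)$$ is exact, that is at $H_m(B,X)$ and $H_m(A,X)$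 for all $m\ge 1$ and at $H_m(A|B,X)$ for all $m\ge 2$. -/

import Mathlib

universe u

open CategoryTheory TensorProduct MulOpposite
open scoped ModuleCat

namespace JZ

/-- The enveloping algebra `Aᵉ = A ⊗ Aᵒᵖ`.  An `A`-bimodule over `k` is a left `Aᵉ`-module, the
element `a ⊗ b` acting by `x ↦ a x b`. -/
abbrev Env (k A : Type u) [Field k] [Ring A] [Algebra k A] : Type u := A ⊗[k] Aᵐᵒᵖ

/-- The category of `A`-bimodules (on which `k` acts centrally). -/
abbrev Bimodule (k A : Type u) [Field k] [Ring A] [Algebra k A] := ModuleCat.{u} (Env k A)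

noncomputable section

section Bimodules

variable (k : Type u) [Field k] {A : Type u} [Ring A] [Algebra k A]

/-- The two-sided multiplication `x ↦ a x b` on a bimodule. -/
abbrev act {X : Bimodule k A} (a b : A) (x : X) : X := (a ⊗ₜ[k] op b : Env k A) • x

/-- An additive map between modules over the enveloping algebra which respects the elements
`a ⊗ b` is linear. -/
theorem map_smul_of_act {M N : Type u} [AddCommGroup M] [AddCommGroup N] [Module (Env k A) M]
    [Module (Env k A) N] (f : M →+ N)
    (h : ∀ (a b : A) (x : M),
      f ((a ⊗ₜ[k] op b : Env k A) • x) = (a ⊗ₜ[k] op b : Env k A) • f x)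
    (r : Env k A) (x : M) : f (r • x) = r • f x :=
  TensorProduct.induction_on (motive := fun r : Env k A => f (r • x) = r • f x) r
    ((congrArg f (zero_smul (Env k A) x)).trans
      ((map_zero f).trans (zero_smul (Env k A) (f x)).symm))
    (fun a b => h a b.unop x)
    (fun r s hr hs => by rw [add_smul, add_smul, map_add, hr, hs])

variable (A) in
/-- The algebra `A` as an `A`-bimodule. -/
def regular : Bimodule k A :=
  letI : Module (Env k A) A := Module.compHom A (AlgHom.mulLeftRight k A).toRingHom
  ModuleCat.of (Env k A) A

/-- An element of `A` as an element of the bimodule `A`. -/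
def regular.of (x : A) : regular k A := x

theorem regular_act (a b x : A) :
    act k a b (regular.of k x) = regular.of k (a * x * b) :=
  AlgHom.mulLeftRight_apply k A a (op b) x

/-! ### The tensor product over the enveloping algebra -/

/-- The subspace of `X ⊗ P` spanned by all `(a x b) ⊗ p - x ⊗ (b p a)`. -/
def tensorRel (X P : Bimodule k A) : Submodule k (X ⊗[k] P) :=
  Submodule.span k
    {z | ∃ (a b : A) (x : X) (p : P), z = act k a b x ⊗ₜ[k] p - x ⊗ₜ[k] act k b a p}

/-- The vector space `X ⊗_{Aᵉ} P` of two `A`-bimodules `X` and `P`, where `X` is made into a right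
`Aᵉ`-module by `x · (b ⊗ a) = a x b`. -/
abbrev BTensor (X P : Bimodule k A) : Type u := (X ⊗[k] P) ⧸ tensorRel k X P

/-- The class of `x ⊗ p` in `X ⊗_{Aᵉ} P`. -/
def BTensor.mk {X P : Bimodule k A} (x : X) (p : P) : BTensor k X P :=
  Submodule.Quotient.mk (x ⊗ₜ[k] p)

theorem BTensor.hom_ext {X P : Bimodule k A} {N : Type u} [AddCommGroup N] [Module k N]
    {f g : BTensor k X P →ₗ[k] N} (h : ∀ x p, f (BTensor.mk k x p) = g (BTensor.mk k x p)) :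
    f = g :=
  Submodule.linearMap_qext _ (TensorProduct.ext' h)

/-- The map `X ⊗_{Aᵉ} P → Y ⊗_{Aᵉ} Q` induced by bimodule maps `X → Y` and `P → Q`. -/
def BTensor.map {X Y P Q : Bimodule k A} (f : X ⟶ Y) (g : P ⟶ Q) :
    BTensor k X P →ₗ[k] BTensor k Y Q :=
  (tensorRel k X P).mapQ (tensorRel k Y Q)
    (TensorProduct.map (f.hom.restrictScalars k) (g.hom.restrictScalars k)) <| by
      rw [tensorRel, Submodule.span_le]
      rintro _ ⟨a, b, x, p, rfl⟩
      refine Submodule.subset_span ⟨a, b, f.hom x, g.hom p, ?_⟩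
      simp

theorem BTensor.map_mk {X Y P Q : Bimodule k A} (f : X ⟶ Y) (g : P ⟶ Q) (x : X) (p : P) :
    BTensor.map k f g (BTensor.mk k x p) = BTensor.mk k (f.hom x) (g.hom p) := rfl

/-- The functor `X ⊗_{Aᵉ} -` from `A`-bimodules to vector spaces. -/
def tensorFunctor (X : Bimodule k A) : Bimodule k A ⥤ ModuleCat.{u} k where
  obj P := ModuleCat.of k (BTensor k X P)
  map g := ModuleCat.ofHom (BTensor.map k (𝟙 X) g)
  map_id _ := ModuleCat.hom_ext (BTensor.hom_ext k fun _ _ => rfl)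
  map_comp _ _ := ModuleCat.hom_ext (BTensor.hom_ext k fun _ _ => rfl)

instance (X : Bimodule k A) : (tensorFunctor k X).Additive where
  map_add {_ _ f g} := ModuleCat.hom_ext <| BTensor.hom_ext k fun x p =>
    congrArg (Submodule.Quotient.mk (p := tensorRel k X _))
      (TensorProduct.tmul_add x (f.hom p) (g.hom p))

/-- The bimodule `P` is flat: `- ⊗_{Aᵉ} P` preserves injections. -/
def IsFlat (P : Bimodule k A) : Prop :=
  ∀ (U V : Bimodule k A) (f : U ⟶ V), Function.Injective f.hom →
    Function.Injective (BTensor.map k f (𝟙 P))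

/-! ### The bar resolution -/

/-- The bimodule structure `a (c ⊗ m) b = a c ⊗ m b` on `A ⊗ M`. -/
def stepAct (M : Bimodule k A) : Env k A →ₐ[k] Module.End k (A ⊗[k] M) :=
  (Module.endTensorEndAlgHom (R := k) (S := k) (A := k) (M := A) (N := M)).comp
    (Algebra.TensorProduct.map (Algebra.lmul k A)
      ((Algebra.lsmul k k M : Env k A →ₐ[k] Module.End k M).comp
        Algebra.TensorProduct.includeRight))

/-- The bimodule `A ⊗ M`. -/
def step (M : Bimodule k A) : Bimodule k A :=
  @ModuleCat.of (Env k A) _ (A ⊗[k] M) _ (Module.compHom (A ⊗[k] M) (stepAct k M).toRingHom)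

theorem step_smul_def {M : Bimodule k A} (r : Env k A) (z : A ⊗[k] M) :
    r • (show step k M from z) = (show step k M from stepAct k M r z) := rfl

theorem step_smul_k {M : Bimodule k A} (c : k) (z : A ⊗[k] M) :
    c • (show step k M from z) = (show step k M from (c • z : A ⊗[k] M)) := by
  change stepAct k M (algebraMap k (Env k A) c) z = c • z
  rw [AlgHom.commutes]
  rfl

/-- The bilinear map `(c, m) ↦ c ⊗ m` to the bimodule `A ⊗ M`. -/
def stepMk (M : Bimodule k A) : A →ₗ[k] M →ₗ[k] step k M :=
  LinearMap.mk₂ k (fun c m => (show step k M from c ⊗ₜ[k] m))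
    (fun c c' m => TensorProduct.add_tmul c c' m)
    (fun r c m => by rw [step_smul_k]; rfl)
    (fun c m m' => TensorProduct.tmul_add c m m')
    (fun r c m => by rw [step_smul_k, ← TensorProduct.tmul_smul])

theorem act_stepMk {M : Bimodule k A} (a b c : A) (m : M) :
    act k a b (stepMk k M c m) = stepMk k M (a * c) (act k 1 b m) := rfl

theorem step_hom_ext {M N : Bimodule k A} {f g : step k M ⟶ N}
    (h : ∀ c m, f.hom (stepMk k M c m) = g.hom (stepMk k M c m)) : f = g := by
  refine ModuleCat.hom_ext (LinearMap.ext fun z => ?_)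
  exact TensorProduct.induction_on (motive := fun z => f.hom z = g.hom z) z
    ((map_zero f.hom).trans (map_zero g.hom).symm) h fun y z hy hz =>
      (map_add f.hom y z).trans ((congrArg₂ (· + ·) hy hz).trans (map_add g.hom y z).symm)

/-- The bimodule map `A ⊗ M → N` given by a bilinear map compatible with the actions. -/
def stepLift {M N : Bimodule k A} (f : A →ₗ[k] M →ₗ[k] N)
    (hf : ∀ a b c m, f (a * c) (act k 1 b m) = act k a b (f c m)) : step k M ⟶ N :=
  let g : step k M →+ N := (TensorProduct.lift f).toAddMonoidHom
  ModuleCat.ofHom (X := step k M) (Y := N)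
    { g with
      map_smul' := map_smul_of_act k g fun a b x =>
        TensorProduct.induction_on
          (motive := fun x => TensorProduct.lift f (stepAct k M (a ⊗ₜ[k] op b) x) =
            (a ⊗ₜ[k] op b : Env k A) • TensorProduct.lift f x) x
          (by simp) (fun c m => hf a b c m)
          (fun y z hy hz => by simp only [map_add, hy, hz, smul_add]) }

theorem stepLift_mk {M N : Bimodule k A} (f : A →ₗ[k] M →ₗ[k] N)
    (hf : ∀ a b c m, f (a * c) (act k 1 b m) = act k a b (f c m)) (c : A) (m : M) :
    (stepLift k f hf).hom (stepMk k M c m) = f c m := rfl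

/-- The bimodule map `A ⊗ M → M`, `c ⊗ m ↦ c m`. -/
def actMap (M : Bimodule k A) : step k M ⟶ M :=
  stepLift k ((Algebra.lsmul k k M : Env k A →ₐ[k] Module.End k M).toLinearMap.comp
      (Algebra.TensorProduct.includeLeft : A →ₐ[k] Env k A).toLinearMap) fun a b c m => by
    change act k (a * c) 1 (act k 1 b m) = act k a b (act k c 1 m)
    simp [act, smul_smul]

theorem actMap_mk {M : Bimodule k A} (c : A) (m : M) :
    (actMap k M).hom (stepMk k M c m) = act k c 1 m := rfl

/-- The bimodule map `A ⊗ M → A ⊗ N`, `c ⊗ m ↦ c ⊗ g m`. -/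
def stepMap {M N : Bimodule k A} (g : M ⟶ N) : step k M ⟶ step k N :=
  stepLift k ((stepMk k N).compl₂ (g.hom.restrictScalars k)) fun a b c m => by
    change stepMk k N (a * c) (g.hom (act k 1 b m)) = act k a b (stepMk k N c (g.hom m))
    rw [map_smul, act_stepMk]

theorem stepMap_mk {M N : Bimodule k A} (g : M ⟶ N) (c : A) (m : M) :
    (stepMap k g).hom (stepMk k M c m) = stepMk k N c (g.hom m) := rfl

theorem actMap_naturality {M N : Bimodule k A} (g : M ⟶ N) :
    actMap k M ≫ g = stepMap k g ≫ actMap k N :=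
  step_hom_ext k fun _ _ => map_smul g.hom _ _

theorem stepMap_comp {M N L : Bimodule k A} (g : M ⟶ N) (h : N ⟶ L) :
    stepMap k (g ≫ h) = stepMap k g ≫ stepMap k h :=
  step_hom_ext k fun _ _ => rfl

theorem stepMap_zero (M N : Bimodule k A) : stepMap k (0 : M ⟶ N) = 0 :=
  step_hom_ext k fun c _ => map_zero (stepMk k N c)

variable (A) in
/-- The bimodule `A^{⊗ (n+1)}`, with `A` acting on the left of the first factor and on the right of
the last one. -/
def barTerm : ℕ → Bimodule k A
  | 0 => regular k A
  | n + 1 => step k (barTerm n)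

/-- The map `A ⊗ A ⊗ N → A ⊗ N`, `a ⊗ y ↦ a y - a ⊗ d y`, attached to a map `d : A ⊗ N → N`. -/
def nextD {N : Bimodule k A} (d : step k N ⟶ N) : step k (step k N) ⟶ step k N :=
  actMap k (step k N) - stepMap k d

variable (A) in
/-- The differential `A^{⊗ (n+2)} → A^{⊗ (n+1)}` of the bar resolution,
`a₀ ⊗ ⋯ ⊗ aₙ₊₁ ↦ ∑ᵢ (-1)ⁱ a₀ ⊗ ⋯ ⊗ aᵢaᵢ₊₁ ⊗ ⋯ ⊗ aₙ₊₁`, through the recursion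
`d (a ⊗ y) = a y - a ⊗ d y`. -/
def barD : ∀ n : ℕ, step k (barTerm k A n) ⟶ barTerm k A n
  | 0 => actMap k (regular k A)
  | n + 1 => nextD k (barD n)

variable (A) in
theorem barD_comp (n : ℕ) : nextD k (barD k A n) ≫ barD k A n = 0 := by
  rw [nextD, Preadditive.sub_comp, actMap_naturality]
  induction n with
  | zero => exact sub_self _
  | succ n ih =>
    change stepMap k (nextD k (barD k A n)) ≫ actMap k (step k (barTerm k A n)) -
      stepMap k (nextD k (barD k A n)) ≫
        (actMap k (step k (barTerm k A n)) - stepMap k (barD k A n)) = 0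
    rw [← Preadditive.comp_sub, sub_sub_cancel, ← stepMap_comp]
    have h : nextD k (barD k A n) ≫ barD k A n = 0 := by
      rw [nextD, Preadditive.sub_comp, actMap_naturality]
      exact ih
    rw [h, stepMap_zero]

variable (A) in
/-- The bar resolution of `A`, with `A ⊗ A^{⊗ n} ⊗ A` in degree `n`. -/
def barComplex : ChainComplex (Bimodule k A) ℕ :=
  ChainComplex.of (fun n => barTerm k A (n + 1)) (fun n => barD k A (n + 1))
    (fun n => barD_comp k A (n + 1))

variable (A) in
theorem barComplex_d (n : ℕ) : (barComplex k A).d (n + 1) n = barD k A (n + 1) :=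
  ChainComplex.of_d (fun n => barTerm k A (n + 1)) (fun n => barD k A (n + 1)) n

variable (A) in
/-- The augmentation `A ⊗ A → A` of the bar resolution, given by the product. -/
def barAug : (barComplex k A).X 0 ⟶ regular k A := barD k A 0

/-- The Hochschild complex `C_*(A, X) = X ⊗_{Aᵉ} (A ⊗ A^{⊗ *} ⊗ A) ≃ X ⊗ A^{⊗ *}`. -/
def hochschildComplex (X : Bimodule k A) : ChainComplex (ModuleCat.{u} k) ℕ :=
  ((tensorFunctor k X).mapHomologicalComplex _).obj (barComplex k A)

/-- Hochschild homology `H_n(A, X)`. -/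
def HH (X : Bimodule k A) (n : ℕ) : ModuleCat.{u} k := (hochschildComplex k X).homology n

end Bimodules

section Extension

variable {k : Type u} [Field k] {A : Type u} [Ring A] [Algebra k A] (B : Subalgebra k A)

/-- The inclusion `Bᵉ → Aᵉ`. -/
def envIncl : Env k B →ₐ[k] Env k A := Algebra.TensorProduct.map B.val (AlgHom.op B.val)

/-- Every `A`-bimodule is a `B`-bimodule by restriction. -/
abbrev res : Bimodule k A ⥤ Bimodule k B := ModuleCat.restrictScalars (envIncl B).toRingHom

theorem res_smul {X : Bimodule k A} (c : k) (x : X) :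
    (c • (show (res B).obj X from x) : (res B).obj X) = (show (res B).obj X from (c • x : X)) := by
  change envIncl B (algebraMap k (Env k B) c) • x = algebraMap k (Env k A) c • x
  rw [AlgHom.commutes]

theorem res_act {X : Bimodule k A} (a b : B) (x : X) :
    act k (X := (res B).obj X) a b x = act k (X := X) (a : A) (b : A) x := rfl

/-- The inclusion `B → A` as a map of `B`-bimodules. -/
def inclBimod : regular k B ⟶ (res B).obj (regular k A) :=
  let f : regular k B →+ (res B).obj (regular k A) :=
    (B.val : B →+ A)
  ModuleCat.ofHom (X := regular k B) (Y := (res B).obj (regular k A))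
    { f with
      map_smul' := map_smul_of_act k f fun a b x =>
        (congrArg f (regular_act k a b x)).trans
          (regular_act k (a : A) (b : A) (B.val x)).symm }

/-- The `B`-bimodule `A / B`. -/
def quotBimod : Bimodule k B :=
  ModuleCat.of (Env k B) ((res B).obj (regular k A) ⧸ LinearMap.range (inclBimod B).hom)

/-! ### Functoriality of the Hochschild complex along `B ⊆ A` -/

/-- The map `X ⊗_{Bᵉ} P → X ⊗_{Aᵉ} Q`, `x ⊗ p ↦ x ⊗ g p`, for an `A`-bimodule `X` and a map `g` of
`B`-bimodules from `P` to the restriction of an `A`-bimodule `Q`. -/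
def tensorRes (X : Bimodule k A) {P : Bimodule k B} {Q : Bimodule k A} (g : P ⟶ (res B).obj Q) :
    BTensor k ((res B).obj X) P →ₗ[k] BTensor k X Q :=
  let i : (res B).obj X →ₗ[k] X :=
    { toFun := fun x => x, map_add' := fun _ _ => rfl, map_smul' := res_smul B }
  let j : P →ₗ[k] Q :=
    { toFun := fun p => g.hom p
      map_add' := map_add g.hom
      map_smul' := fun c p => (map_smul (g.hom.restrictScalars k) c p).trans (res_smul B c _) }
  (tensorRel k _ P).mapQ (tensorRel k X Q) (TensorProduct.map i j) <| by
    rw [tensorRel, Submodule.span_le]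
    rintro _ ⟨a, b, x, p, rfl⟩
    refine Submodule.subset_span ⟨a, b, x, g.hom p, ?_⟩
    rw [map_sub, TensorProduct.map_tmul, TensorProduct.map_tmul]
    have h : j (act k b a p) = act k (b : A) (a : A) (show Q from g.hom p) :=
      map_smul g.hom _ p
    rw [h]
    rfl

/-- The map `B ⊗ M → A ⊗ N`, `b ⊗ m ↦ b ⊗ g m`. -/
def stepRes {M : Bimodule k B} {N : Bimodule k A} (g : M ⟶ (res B).obj N) :
    step k M ⟶ (res B).obj (step k N) :=
  let f : B →ₗ[k] M →ₗ[k] (res B).obj (step k N) :=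
    LinearMap.mk₂ k (fun b m => stepMk k N b (g.hom m))
      (fun b b' m => LinearMap.map_add₂ (stepMk k N) b b' (g.hom m))
      (fun r b m => (LinearMap.map_smul₂ (stepMk k N) r (b : A) (g.hom m)).trans
        (res_smul B r _).symm)
      (fun b m m' => (congrArg (stepMk k N b) (map_add g.hom m m')).trans
        (map_add (stepMk k N b) _ _))
      (fun r b m => (congrArg (stepMk k N b)
        ((map_smul (g.hom.restrictScalars k) r m).trans (res_smul B r _))).trans
          ((map_smul (stepMk k N b) r _).trans (res_smul B r _).symm))
  stepLift k f fun a b c m =>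
    congrArg (stepMk k N (a * c : A)) (map_smul g.hom ((1 : B) ⊗ₜ[k] op b : Env k B) m)

theorem stepRes_mk {M : Bimodule k B} {N : Bimodule k A} (g : M ⟶ (res B).obj N) (b : B) (m : M) :
    (stepRes B g).hom (stepMk k M b m) = stepMk k N b (g.hom m) := rfl

theorem stepRes_actMap {M : Bimodule k B} {N : Bimodule k A} (g : M ⟶ (res B).obj N) :
    stepRes B g ≫ (res B).map (actMap k N) = actMap k M ≫ g :=
  step_hom_ext k fun b m => (map_smul g.hom (b ⊗ₜ[k] op 1 : Env k B) m).symm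

theorem stepRes_stepMap {M M' : Bimodule k B} {N N' : Bimodule k A} (g : M ⟶ (res B).obj N)
    (g' : M' ⟶ (res B).obj N') (d : M ⟶ M') (e : N ⟶ N') (h : g ≫ (res B).map e = d ≫ g') :
    stepRes B g ≫ (res B).map (stepMap k e) = stepMap k d ≫ stepRes B g' :=
  step_hom_ext k fun b m =>
    congrArg (stepMk k N' (b : A)) (LinearMap.congr_fun (congrArg ModuleCat.Hom.hom h) m)

/-- The inclusion `B^{⊗ (n+1)} → A^{⊗ (n+1)}`. -/
def barIncl : ∀ n : ℕ, barTerm k B n ⟶ (res B).obj (barTerm k A n)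
  | 0 => inclBimod B
  | n + 1 => stepRes B (barIncl n)

theorem barIncl_comm : ∀ n : ℕ,
    stepRes B (barIncl B n) ≫ (res B).map (barD k A n) = barD k B n ≫ barIncl B n
  | 0 => stepRes_actMap B _
  | n + 1 => by
    change stepRes B (stepRes B (barIncl B n)) ≫ (res B).map (nextD k (barD k A n)) =
      nextD k (barD k B n) ≫ stepRes B (barIncl B n)
    rw [nextD, nextD, Functor.map_sub, Preadditive.comp_sub, Preadditive.sub_comp,
      stepRes_actMap, stepRes_stepMap B _ _ _ _ (barIncl_comm n)]

/-- The chain map `C_*(B, X) → C_*(A, X)`, `x ⊗ y ↦ x ⊗ y`, induced by the inclusion. -/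
def inclComplex (X : Bimodule k A) :
    hochschildComplex k ((res B).obj X) ⟶ hochschildComplex k X where
  f n := ModuleCat.ofHom (tensorRes B X (barIncl B (n + 1)))
  comm' i j hij := by
    obtain rfl : j + 1 = i := hij
    refine ModuleCat.hom_ext (BTensor.hom_ext k fun x p => ?_)
    have h := LinearMap.congr_fun (congrArg ModuleCat.Hom.hom (barIncl_comm B (j + 1))) p
    change BTensor.mk k (P := barTerm k A (j + 1)) x
        (((barComplex k A).d (j + 1) j).hom ((stepRes B (barIncl B (j + 1))).hom p)) =
      BTensor.mk k (P := barTerm k A (j + 1)) x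
        ((barIncl B (j + 1)).hom (((barComplex k B).d (j + 1) j).hom p))
    rw [barComplex_d, barComplex_d]
    exact congrArg (BTensor.mk k (P := barTerm k A (j + 1)) x) h

/-! ### Relative homological algebra for `Bᵉ ⊆ Aᵉ` -/

/-- An `A`-bimodule `P` is projective relative to `B` if bimodule maps from `P` lift through all
maps of `A`-bimodules that split as maps of `B`-bimodules. -/
def IsRelProjective (P : Bimodule k A) : Prop :=
  ∀ (M N : Bimodule k A) (g : M ⟶ N) (s : (res B).obj N ⟶ (res B).obj M),
    s ≫ (res B).map g = 𝟙 _ → ∀ f : P ⟶ N, ∃ h : P ⟶ M, h ≫ g = f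

/-- A relative projective resolution of the `A`-bimodule `Y`: an augmented complex
`⋯ → P₁ → P₀ → Y → 0` of `A`-bimodules, with all `Pₙ` relative projective, which has a contracting
homotopy of `B`-bimodules (given by `Y → P₀` and maps `Pₙ → Pₙ₊₁`). -/
structure RelResolution (Y : Bimodule k A) where
  /-- The complex of the `Pₙ`. -/
  complex : ChainComplex (Bimodule k A) ℕ
  /-- The augmentation `P₀ → Y`. -/
  aug : complex.X 0 ⟶ Y
  relProjective : ∀ n, IsRelProjective B (complex.X n)
  d_comp_aug : complex.d 1 0 ≫ aug = 0
  contractible : ∃ (s' : (res B).obj Y ⟶ (res B).obj (complex.X 0))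
      (s : ∀ n, (res B).obj (complex.X n) ⟶ (res B).obj (complex.X (n + 1))),
    s' ≫ (res B).map aug = 𝟙 _ ∧
    (res B).map aug ≫ s' + s 0 ≫ (res B).map (complex.d 1 0) = 𝟙 _ ∧
    ∀ n, (res B).map (complex.d (n + 1) n) ≫ s n +
      s (n + 1) ≫ (res B).map (complex.d (n + 2) (n + 1)) = 𝟙 _

variable {B}

/-- The complex `X ⊗_{Aᵉ} P` for a relative projective resolution `P`. -/
def RelResolution.tensor {Y : Bimodule k A} (P : RelResolution B Y) (X : Bimodule k A) :
    ChainComplex (ModuleCat.{u} k) ℕ :=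
  ((tensorFunctor k X).mapHomologicalComplex _).obj P.complex

/-- The relative homology `Tor_n^{Aᵉ|Bᵉ}(X, Y)`, computed by the relative projective resolution `P`
of `Y`.  For `Y = A` this is the relative Hochschild homology `H_n(A|B, X)`. -/
def RelResolution.relTor {Y : Bimodule k A} (P : RelResolution B Y) (X : Bimodule k A) (n : ℕ) :
    ModuleCat.{u} k :=
  (P.tensor X).homology n

/-- A comparison map: a chain map of `A`-bimodules from the bar resolution of `A` to a relative
projective resolution of `A`, which lifts the identity of `A`. -/
def RelResolution.IsComparison (P : RelResolution B (regular k A))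
    (φ : barComplex k A ⟶ P.complex) : Prop :=
  φ.f 0 ≫ P.aug = barAug k A

/-- The map `K : H_n(A, X) → H_n(A|B, X)` induced by a comparison map. -/
def mapK {P : RelResolution B (regular k A)} (φ : barComplex k A ⟶ P.complex)
    (X : Bimodule k A) (n : ℕ) : HH k X n ⟶ P.relTor X n :=
  HomologicalComplex.homologyMap
    (((tensorFunctor k X).mapHomologicalComplex (ComplexShape.down ℕ)).map φ) n

variable (B) in
/-- The map `I : H_n(B, X) → H_n(A, X)` induced by the inclusion. -/
def mapI (X : Bimodule k A) (n : ℕ) : HH k ((res B).obj X) n ⟶ HH k X n :=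
  HomologicalComplex.homologyMap (inclComplex B X) n

end Extension
end

end JZ

open JZ

/-!
Over a field, `M ↦ Hom_k(M, W)` turns flat bimodules into injective ones, so if `A / B` is flat over
`Bᵉ`, then restriction from `Aᵉ` to `Bᵉ` preserves injectives, hence flats.

Let `Q = A ⊗_B Bar(B) ⊗_B A`, so that `X ⊗_{Aᵉ} Q` is the Hochschild complex of `B` with
coefficients in `X`. The natural map `Q → Bar(A)` is a degreewise split injection with cokernel `E`.
Choose a relative resolution `R` of `A` with `R₀ = A ⊗_B A`, and let `R'' = coker (R₀[0] → R)`.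
By flatness `Q` is a resolution of `A ⊗_B A` and the terms of `R''` are flat. Comparing
`Q → Bar(A) → E` with `R₀[0] → R → R''` gives a quasi-isomorphism `E → R''` of complexes of flat
bimodules, so `X ⊗ E → X ⊗ R''` is a quasi-isomorphism too. As `X ⊗ R₀[0]` lives in degree `0`,
the complexes `X ⊗ R` and `X ⊗ R''` have the same homology in degrees at least `2`, and the
first embeds into the second in degree `1`. The Jacobi-Zariski sequence is the long exact sequence
of `X ⊗ Q → X ⊗ Bar(A) → X ⊗ E`.
-/

namespace JZ

open Limits HomologicalComplex

noncomputable section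

section Lifting

universe v w

variable {V : Type w} [Category.{v} V] [Preadditive V]

/-- The functor `Hom(T, -)` makes the augmented complex `⋯ → C₁ → C₀ → Y → 0` exact. This is the
property of `T` and `C` by which chain maps and homotopies into `C` are built degree by degree. -/
structure HomExact (T : V) (C : ChainComplex V ℕ) {Y : V} (ε : C.X 0 ⟶ Y) : Prop where
  lift_aug (f : T ⟶ Y) : ∃ g, g ≫ ε = f
  lift_zero (f : T ⟶ C.X 0) : f ≫ ε = 0 → ∃ g, g ≫ C.d 1 0 = f
  lift_succ (n : ℕ) (f : T ⟶ C.X (n + 1)) : f ≫ C.d (n + 1) n = 0 →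
    ∃ g, g ≫ C.d (n + 2) (n + 1) = f

variable {P C : ChainComplex V ℕ} {Y : V} {ε : C.X 0 ⟶ Y}

theorem exists_hom_of_homExact (h : ∀ n, HomExact (P.X n) C ε)
    (η : P.X 0 ⟶ Y) (hη : P.d 1 0 ≫ η = 0) : ∃ φ : P ⟶ C, φ.f 0 ≫ ε = η := by
  obtain ⟨zero, hzero⟩ := (h 0).lift_aug η
  obtain ⟨one, hone⟩ := (h 1).lift_zero (P.d 1 0 ≫ zero) (by rw [Category.assoc, hzero, hη])
  have succ (n : ℕ) (p : Σ' (f : P.X n ⟶ C.X n) (f' : P.X (n + 1) ⟶ C.X (n + 1)),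
      f' ≫ C.d (n + 1) n = P.d (n + 1) n ≫ f) :
      ∃ f'', f'' ≫ C.d (n + 2) (n + 1) = P.d (n + 2) (n + 1) ≫ p.2.1 :=
    (h (n + 2)).lift_succ n _ (by rw [Category.assoc, p.2.2, d_comp_d_assoc, zero_comp])
  refine ⟨ChainComplex.mkHom P C zero one hone fun n p =>
    ⟨(succ n p).choose, (succ n p).choose_spec⟩, ?_⟩
  rw [ChainComplex.mkHom_f_0, hzero]

theorem homotopy_of_homExact (h : ∀ n, HomExact (P.X n) C ε) {φ ψ : P ⟶ C}
    (hφψ : φ.f 0 ≫ ε = ψ.f 0 ≫ ε) : Nonempty (Homotopy φ ψ) := by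
  set e := φ - ψ
  obtain ⟨zero, hzero⟩ := (h 0).lift_zero (e.f 0) (by simp [e, hφψ])
  obtain ⟨one, hone⟩ := (h 1).lift_succ 0 (e.f 1 - P.d 1 0 ≫ zero) (by simp [hzero])
  have succ (n : ℕ) (p : Σ' (f : P.X n ⟶ C.X (n + 1)) (f' : P.X (n + 1) ⟶ C.X (n + 2)),
      e.f (n + 1) = P.d (n + 1) n ≫ f + f' ≫ C.d (n + 2) (n + 1)) :
      ∃ f'', f'' ≫ C.d (n + 3) (n + 2) = e.f (n + 2) - P.d (n + 2) (n + 1) ≫ p.2.1 :=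
    (h (n + 2)).lift_succ (n + 1) _ (by simp [p.2.2])
  exact ⟨Homotopy.equivSubZero.symm <| Homotopy.mkInductive e zero hzero.symm one
    (by rw [hone, add_sub_cancel]) fun n p => ⟨(succ n p).choose, by
      rw [(succ n p).choose_spec, add_sub_cancel]⟩⟩

theorem comp_eq_comp_of_homotopy {φ ψ : P ⟶ C} (h : Homotopy φ ψ) (hε : C.d 1 0 ≫ ε = 0) :
    φ.f 0 ≫ ε = ψ.f 0 ≫ ε := by
  rw [h.comm 0, Homotopy.dNext_zero_chainComplex, Homotopy.prevD_chainComplex, zero_add,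
    Preadditive.add_comp, Category.assoc, hε, comp_zero, zero_add]

theorem exists_homotopic_comp_eq {Q : ChainComplex V ℕ} {ι : Q ⟶ P} {r : ∀ n, P.X n ⟶ Q.X n}
    (hr : ∀ n, ι.f n ≫ r n = 𝟙 _) {φ : P ⟶ C} {θ : Q ⟶ C} (h : Homotopy (ι ≫ φ) θ) :
    ∃ φ' : P ⟶ C, Nonempty (Homotopy φ φ') ∧ ι ≫ φ' = θ := by
  let t := Homotopy.nullHomotopicMap fun i j => r i ≫ h.hom i j
  have ht : Homotopy t 0 := Homotopy.nullHomotopy _ fun i j hij => by rw [h.zero i j hij, comp_zero]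
  refine ⟨φ - t, ⟨Homotopy.equivSubZero.symm (by rwa [sub_sub_cancel])⟩, ?_⟩
  have hιt : ι ≫ t = Homotopy.nullHomotopicMap h.hom := by
    simp only [t, Homotopy.comp_nullHomotopicMap, reassoc_of% hr]
  rw [Preadditive.comp_sub, hιt, sub_eq_iff_eq_add]
  ext n
  rw [h.comm n, add_comm]
  rfl

end Lifting

section Homology

universe v w

theorem quasiIso_toSingle₀ {V : Type w} [Category.{v} V] [Abelian V] {C : ChainComplex V ℕ} {Y : V}
    (ε : C.X 0 ⟶ Y) (hε : C.d 1 0 ≫ ε = 0) [Epi ε] (h₀ : (ShortComplex.mk _ _ hε).Exact)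
    (h : ∀ n, C.ExactAt (n + 1)) : QuasiIso ((C.toSingle₀Equiv Y).symm ⟨ε, hε⟩) where
  quasiIsoAt n := by
    cases n with
    | zero =>
      rw [ChainComplex.quasiIsoAt₀_iff,
        ShortComplex.quasiIso_iff_of_zeros' _ (C.shape 0 0 (by simp)) rfl rfl]
      refine (ShortComplex.exact_and_epi_g_iff_of_iso ?_).2 ⟨h₀, ‹Epi ε›⟩
      exact ShortComplex.isoMk (Iso.refl _) (Iso.refl _) (Iso.refl _)
        ((Category.id_comp (C.d 1 0)).trans (Category.comp_id (C.d 1 0)).symm)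
        ((Category.id_comp ε).trans
          ((congrArg (· ≫ 𝟙 Y) (C.toSingle₀Equiv_symm_apply_f_zero ε hε)).trans
            (Category.comp_id ε)).symm)
    | succ n =>
      rw [quasiIsoAt_iff_exactAt' _ _ (ChainComplex.exactAt_succ_single_obj ..)]
      exact h n

theorem mono_homologyMap_g {C ι : Type*} [Category C] [Abelian C] {c : ComplexShape ι}
    {S : ShortComplex (HomologicalComplex C c)} (hS : S.ShortExact) {i : ι}
    (hi : S.X₁.ExactAt i) : Mono (homologyMap S.g i) :=
  (hS.homology_exact₂ i).mono_g (((exactAt_iff_isZero_homology _ _).1 hi).eq_of_src _ _)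

theorem isIso_homologyMap_g {C ι : Type*} [Category C] [Abelian C] {c : ComplexShape ι}
    {S : ShortComplex (HomologicalComplex C c)} (hS : S.ShortExact) {i j : ι} (hij : c.Rel i j)
    (hi : S.X₁.ExactAt i) (hj : S.X₁.ExactAt j) : IsIso (homologyMap S.g i) := by
  have := mono_homologyMap_g hS hi
  have : Epi (homologyMap S.g i) := (hS.homology_exact₃ i j hij).epi_f
    (((exactAt_iff_isZero_homology _ _).1 hj).eq_of_tgt _ _)
  exact isIso_of_mono_of_epi _

theorem exists_connecting_of_shortExact {R : Type u} [Ring R]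
    {S T : ShortComplex (ChainComplex (ModuleCat.{u} R) ℕ)} (hS : S.ShortExact) (hT : T.ShortExact)
    (f : S.X₂ ⟶ T.X₂) (g : S.X₃ ⟶ T.X₃) (_ : QuasiIso g) (hfg : S.g ≫ g = f ≫ T.g)
    (h : ∀ n, T.X₁.ExactAt (n + 1)) :
    ∃ δ : ∀ n, T.X₂.homology (n + 1) ⟶ S.X₁.homology n, ∀ n, 1 ≤ n →
      Function.Exact (homologyMap S.f n).hom (homologyMap f n).hom ∧
      Function.Exact (homologyMap f (n + 1)).hom (δ n).hom ∧
      Function.Exact (δ n).hom (homologyMap S.f n).hom := by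
  have rel (n : ℕ) : (ComplexShape.down ℕ).Rel (n + 1) n := rfl
  have comm (n : ℕ) : homologyMap f n ≫ homologyMap T.g n =
      homologyMap S.g n ≫ homologyMap g n := by
    rw [← homologyMap_comp, ← homologyMap_comp, hfg]
  refine ⟨fun n => (homologyMap T.g (n + 1) ≫ inv (homologyMap g (n + 1))) ≫
    hS.δ (n + 1) n (rel n), fun n hn => ?_⟩
  obtain ⟨n, rfl⟩ := Nat.exists_eq_add_of_le' hn
  have := isIso_homologyMap_g hT (rel (n + 1)) (h (n + 1)) (h n)
  have hexact {U : ShortComplex (ModuleCat.{u} R)} (hU : U.Exact) :=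
    (ShortComplex.ShortExact.moduleCat_exact_iff_function_exact U).1 hU
  have exact₂ (i : ℕ) : Function.Exact (homologyMap S.f i).hom
      (homologyMap f i ≫ homologyMap T.g i).hom := by
    rw [comm, ModuleCat.hom_comp, LinearMap.coe_comp]
    have injective := (ModuleCat.mono_iff_injective (homologyMap g i)).1 inferInstance
    exact injective.comp_exact_iff_exact.2 (hexact (hS.homology_exact₂ i))
  have bij : Function.Bijective (homologyMap T.g (n + 2) ≫ inv (homologyMap g (n + 2))).hom :=
    (ConcreteCategory.isIso_iff_bijective _).1 inferInstance
  have exact₃ : Function.Exact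
      (homologyMap f (n + 2) ≫ homologyMap T.g (n + 2) ≫ inv (homologyMap g (n + 2))).hom
      (hS.δ (n + 2) (n + 1) (rel _)).hom := by
    rw [← Category.assoc, comm, Category.assoc, IsIso.hom_inv_id, Category.comp_id]
    exact hexact (hS.homology_exact₃ (n + 2) (n + 1) (rel _))
  refine ⟨?_, fun y => ?_, ?_⟩
  · have injective := (ModuleCat.mono_iff_injective _).1 (mono_homologyMap_g hT (h n))
    exact injective.comp_exact_iff_exact.1 (exact₂ (n + 1))
  · rw [ModuleCat.hom_comp, LinearMap.comp_apply, exact₃]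
    exact ⟨fun ⟨x, hx⟩ => ⟨x, bij.1 hx⟩, fun ⟨x, hx⟩ => ⟨x, by rw [← hx]; rfl⟩⟩
  · rw [ModuleCat.hom_comp, LinearMap.coe_comp]
    exact (bij.2.comp_exact_iff_exact).2 (hexact (hS.homology_exact₁ (n + 2) (n + 1) (rel _)))

end Homology

section Duality

variable (k : Type u) [Field k] {A : Type u} [Ring A] [Algebra k A]

variable (A) in
/-- The anti-automorphism `a ⊗ b ↦ b ⊗ a` of `Aᵉ`, which turns left modules into right modules. -/
def envSwap : Env k A →ₐ[k] (Env k A)ᵐᵒᵖ :=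
  Algebra.TensorProduct.lift
    ((AlgHom.op Algebra.TensorProduct.includeRight).comp (AlgEquiv.opOp k A).toAlgHom)
    (AlgHom.op Algebra.TensorProduct.includeLeft) fun a b => by
      change op ((1 : A) ⊗ₜ[k] op a) * op (b.unop ⊗ₜ[k] (1 : Aᵐᵒᵖ)) =
        op (b.unop ⊗ₜ[k] (1 : Aᵐᵒᵖ)) * op ((1 : A) ⊗ₜ[k] op a)
      simp [← op_mul]

theorem envSwap_tmul (a b : A) : envSwap k A (a ⊗ₜ[k] op b) = op (b ⊗ₜ[k] op a) := by
  change op ((1 : A) ⊗ₜ[k] op a) * op (b ⊗ₜ[k] (1 : Aᵐᵒᵖ)) = _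
  simp [← op_mul]

/-- The action of `Aᵉ` on `Hom_k(P, W)` given by `(a ⊗ b) f = f (b · a)`. -/
def dualAct (P : Bimodule k A) (W : Type u) [AddCommGroup W] [Module k W] :
    Env k A →ₐ[k] Module.End k (P →ₗ[k] W) :=
  let rightAct : (Env k A)ᵐᵒᵖ →ₐ[k] Module.End k (P →ₗ[k] W) :=
    { toFun := fun r => LinearMap.lcomp k W (Algebra.lsmul k k P r.unop)
      map_one' := by ext; simp
      map_mul' := fun r s => by ext; simp
      map_zero' := by ext; simp
      map_add' := fun r s => by ext; simp
      commutes' := fun c => LinearMap.ext fun f => LinearMap.ext fun p =>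
        (congrArg f (algebraMap_smul (Env k A) c p)).trans (map_smul f c p) }
  rightAct.comp (envSwap k A)

/-- The `A`-bimodule `Hom_k(P, W)`, for an `A`-bimodule `P` and a vector space `W`, in which
`a f b` is `p ↦ f (b p a)`. -/
def dual (P : Bimodule k A) (W : ModuleCat.{u} k) : Bimodule k A :=
  @ModuleCat.of (Env k A) _ (P →ₗ[k] W) _ (Module.compHom (P →ₗ[k] W) (dualAct k P W).toRingHom)

variable {k}

/-- The elements of the bimodule `dual k P W` are the linear maps `P → W`. -/
def dual.equiv {P : Bimodule k A} {W : ModuleCat.{u} k} : dual k P W ≃+ (P →ₗ[k] W) :=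
  AddEquiv.refl _

theorem dual.equiv_act {P : Bimodule k A} {W : ModuleCat.{u} k} (a b : A) (f : dual k P W) (p : P) :
    dual.equiv (act k a b f) p = dual.equiv f (act k b a p) := by
  change dualAct k P W (a ⊗ₜ[k] op b) (dual.equiv f) p = _
  simp [dualAct, envSwap_tmul]

theorem dual.equiv_smul {P : Bimodule k A} {W : ModuleCat.{u} k} (c : k) (f : dual k P W) :
    dual.equiv (c • f) = c • dual.equiv f := by
  change dualAct k P W (algebraMap k (Env k A) c) (dual.equiv f) = _
  rw [AlgHom.commutes]
  rfl

/-- A bimodule map out of an additive map which respects the two-sided multiplications. -/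
def bimoduleHom {X Y : Bimodule k A} (f : X →+ Y)
    (hf : ∀ a b x, f (act k a b x) = act k a b (f x)) : X ⟶ Y :=
  ModuleCat.ofHom { f with map_smul' := map_smul_of_act k f hf }

/-- The map `Hom_k(Q, W) → Hom_k(P, V)` induced by `P → Q` and `W → V`. -/
def dualMap {P Q : Bimodule k A} {V W : ModuleCat.{u} k} (f : P ⟶ Q) (g : W ⟶ V) :
    dual k Q W ⟶ dual k P V :=
  bimoduleHom
    { toFun := fun h => dual.equiv.symm (g.hom ∘ₗ dual.equiv h ∘ₗ f.hom.restrictScalars k)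
      map_zero' := by simp
      map_add' := fun h h' => by simp [LinearMap.comp_add, LinearMap.add_comp] }
    fun a b h => dual.equiv.injective <| LinearMap.ext fun p => by
      simp [dual.equiv_act]

variable (k) in
/-- The functor `Hom_k(P, -)` from vector spaces to `A`-bimodules. -/
def dualFunctor (P : Bimodule k A) : ModuleCat.{u} k ⥤ Bimodule k A where
  obj W := dual k P W
  map g := dualMap (𝟙 P) g
  map_id _ := rfl
  map_comp _ _ := rfl

/-- The linear map on `X ⊗_{Aᵉ} P` given by a balanced bilinear map. -/
def BTensor.lift {X P : Bimodule k A} {W : ModuleCat.{u} k} (f : X →ₗ[k] P →ₗ[k] W)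
    (hf : ∀ a b x p, f (act k a b x) p = f x (act k b a p)) : BTensor k X P →ₗ[k] W :=
  (tensorRel k X P).liftQ (TensorProduct.lift f) <| by
    rw [tensorRel, Submodule.span_le]
    rintro _ ⟨a, b, x, p, rfl⟩
    simp [hf]

theorem BTensor.lift_mk {X P : Bimodule k A} {W : ModuleCat.{u} k} (f : X →ₗ[k] P →ₗ[k] W)
    (hf : ∀ a b x p, f (act k a b x) p = f x (act k b a p)) (x : X) (p : P) :
    BTensor.lift f hf (BTensor.mk k x p) = f x p :=
  TensorProduct.lift.tmul x p

/-- The bilinear map `(x, p) ↦ x ⊗ p`. -/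
def BTensor.mkₗ (X P : Bimodule k A) : X →ₗ[k] P →ₗ[k] BTensor k X P :=
  (TensorProduct.mk k X P).compr₂ (tensorRel k X P).mkQ

theorem BTensor.mk_act {X P : Bimodule k A} (a b : A) (x : X) (p : P) :
    BTensor.mk k (act k a b x) p = BTensor.mk k x (act k b a p) :=
  (Submodule.Quotient.eq _).2 (Submodule.subset_span ⟨a, b, x, p, rfl⟩)

/-- Linear maps `X ⊗_{Aᵉ} P → W` are bimodule maps `P → Hom_k(X, W)`. -/
def tensorHomEquiv (X P : Bimodule k A) (W : ModuleCat.{u} k) :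
    (BTensor k X P →ₗ[k] W) ≃ (P ⟶ dual k X W) where
  toFun φ := bimoduleHom
    { toFun := fun p => dual.equiv.symm (φ ∘ₗ (BTensor.mkₗ X P).flip p)
      map_zero' := by simp
      map_add' := fun p q => by simp [LinearMap.comp_add] }
    fun a b p => dual.equiv.injective <| LinearMap.ext fun x =>
      (congrArg φ (BTensor.mk_act b a x p).symm).trans
        (dual.equiv_act a b (dual.equiv.symm (φ ∘ₗ (BTensor.mkₗ X P).flip p)) x).symm
  invFun F := BTensor.lift (LinearMap.flip
    { toFun := fun p => dual.equiv (F.hom p)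
      map_add' := fun p q => by simp
      map_smul' := fun c p => by
        rw [← dual.equiv_smul]
        exact congrArg dual.equiv (map_smul (F.hom.restrictScalars k) c p) }) fun a b x p =>
      (dual.equiv_act b a (F.hom p) x).symm.trans
        (congrArg (fun f => dual.equiv f x) (map_smul F.hom _ p).symm)
  left_inv φ := BTensor.hom_ext k fun x p => BTensor.lift_mk _ _ x p
  right_inv F := rfl

theorem dual.hom_ext {X P : Bimodule k A} {W : ModuleCat.{u} k} {f g : P ⟶ dual k X W}
    (h : ∀ p x, dual.equiv (f.hom p) x = dual.equiv (g.hom p) x) : f = g :=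
  ModuleCat.hom_ext <| LinearMap.ext fun p => dual.equiv.injective <| LinearMap.ext (h p)

variable (k) in
/-- The tensor-hom adjunction. -/
def tensorDualAdj (X : Bimodule k A) : tensorFunctor k X ⊣ dualFunctor k X :=
  Adjunction.mkOfHomEquiv
    { homEquiv := fun P W => ModuleCat.homEquiv.trans (tensorHomEquiv X P W)
      homEquiv_naturality_left_symm := fun _ _ =>
        ModuleCat.hom_ext <| BTensor.hom_ext k fun _ _ => rfl
      homEquiv_naturality_right := fun _ _ => dual.hom_ext fun _ _ => rfl }

/-- The symmetry `x ⊗ p ↦ p ⊗ x`. -/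
def BTensor.comm (X P : Bimodule k A) : BTensor k X P ≃ₗ[k] BTensor k P X :=
  .ofLinearMap
    (BTensor.lift (W := .of k _) (BTensor.mkₗ P X).flip fun a b x p =>
      (BTensor.mk_act b a p x).symm)
    (BTensor.lift (W := .of k _) (BTensor.mkₗ X P).flip fun a b p x =>
      (BTensor.mk_act b a x p).symm)
    (BTensor.hom_ext k fun _ _ => rfl) (BTensor.hom_ext k fun _ _ => rfl)

theorem isFlat_iff_preservesMonomorphisms {P : Bimodule k A} :
    IsFlat k P ↔ (tensorFunctor k P).PreservesMonomorphisms := by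
  have key {U V : Bimodule k A} (f : U ⟶ V) : Function.Injective (BTensor.map k f (𝟙 P)) ↔
      Mono ((tensorFunctor k P).map f) := by
    have h : BTensor.map k (𝟙 P) f ∘ BTensor.comm U P =
        BTensor.comm V P ∘ BTensor.map k f (𝟙 P) :=
      congrArg DFunLike.coe (BTensor.hom_ext k fun _ _ => rfl :
        BTensor.map k (𝟙 P) f ∘ₗ (BTensor.comm U P).toLinearMap =
          (BTensor.comm V P).toLinearMap ∘ₗ BTensor.map k f (𝟙 P))
    rw [ModuleCat.mono_iff_injective, ← EquivLike.comp_injective _ (BTensor.comm V P), ← h,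
      EquivLike.injective_comp]
    rfl
  exact ⟨fun h => ⟨fun f hf => (key f).1 (h _ _ f ((ModuleCat.mono_iff_injective f).1 hf))⟩,
    fun h U V f hf => (key f).2 (have := (ModuleCat.mono_iff_injective f).2 hf; inferInstance)⟩

instance (W : ModuleCat.{u} k) : Injective W :=
  (Module.injective_iff_injective_object k W).1 (Module.injective_of_isSemisimpleRing k W)

theorem isFlat_iff_injective_dual {P : Bimodule k A} :
    IsFlat k P ↔ ∀ W, Injective (dual k P W) := by
  rw [isFlat_iff_preservesMonomorphisms]
  constructor
  · intro h W
    exact (tensorDualAdj k P).map_injective W inferInstance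
  · intro h
    have : (dualFunctor k P).PreservesInjectiveObjects := ⟨fun {W} _ => h W⟩
    exact Functor.preservesMonomorphisms_of_adjunction_of_preservesInjectiveObjects
      (tensorDualAdj k P)

theorem isFlat_iff_exists_factor {P : Bimodule k A} :
    IsFlat k P ↔ ∀ {X Y : Bimodule k A} (f : X ⟶ Y) [Mono f] (W : ModuleCat.{u} k)
      (g : P ⟶ dual k X W), ∃ g' : P ⟶ dual k Y W, g' ≫ dualMap f (𝟙 W) = g := by
  constructor
  · intro h X Y f _ W g
    obtain ⟨r, hr⟩ := (BTensor.map k f (𝟙 P)).exists_leftInverse_of_injective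
      (LinearMap.ker_eq_bot.2 (h X Y f ((ModuleCat.mono_iff_injective f).1 inferInstance)))
    let φ := (tensorHomEquiv X P W).symm g
    refine ⟨tensorHomEquiv Y P W (φ ∘ₗ r), (tensorHomEquiv X P W).symm.injective ?_⟩
    refine BTensor.hom_ext k fun x p => congrArg φ (LinearMap.congr_fun hr (BTensor.mk k x p))
  · intro h X Y f hf
    have := (ModuleCat.mono_iff_injective f).2 hf
    let W := ModuleCat.of k (BTensor k X P)
    obtain ⟨g, hg⟩ := h f W (tensorHomEquiv X P W LinearMap.id)
    have hg' : (tensorHomEquiv Y P W).symm g ∘ₗ BTensor.map k f (𝟙 P) = LinearMap.id :=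
      BTensor.hom_ext k fun x p =>
        congrArg (fun g : P ⟶ dual k X W => dual.equiv (g.hom p) x) hg
    exact Function.LeftInverse.injective (LinearMap.congr_fun hg')

theorem epi_dualMap {P Q : Bimodule k A} (f : P ⟶ Q) [Mono f] (W : ModuleCat.{u} k) :
    Epi (dualMap f (𝟙 W)) := by
  obtain ⟨r, hr⟩ := (f.hom.restrictScalars k).exists_leftInverse_of_injective
    (LinearMap.ker_eq_bot.2 ((ModuleCat.mono_iff_injective f).1 inferInstance))
  exact (ModuleCat.epi_iff_surjective _).2 fun h =>
    ⟨dual.equiv.symm (dual.equiv h ∘ₗ r), dual.equiv.injective <| LinearMap.ext fun u =>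
      congrArg (dual.equiv h) (LinearMap.congr_fun hr u)⟩

theorem isFlat_of_projective (P : Bimodule k A) [Projective P] : IsFlat k P :=
  isFlat_iff_exists_factor.2 fun f _ W g =>
    have := epi_dualMap f W
    ⟨Projective.factorThru g (dualMap f (𝟙 W)), Projective.factorThru_comp g _⟩

theorem IsFlat.of_retract {P Q : Bimodule k A} (h : Retract P Q) (hQ : IsFlat k Q) :
    IsFlat k P :=
  isFlat_iff_exists_factor.2 fun f _ W g => by
    obtain ⟨g', hg'⟩ := isFlat_iff_exists_factor.1 hQ f W (h.r ≫ g)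
    exact ⟨h.i ≫ g', by rw [Category.assoc, hg', h.retract_assoc]⟩

theorem preservesHomology_tensorFunctor {P : Bimodule k A} (hP : IsFlat k P) :
    (tensorFunctor k P).PreservesHomology := by
  have := isFlat_iff_preservesMonomorphisms.1 hP
  have := (tensorDualAdj k P).leftAdjoint_preservesColimits
  exact (tensorFunctor k P).preservesHomology_of_preservesMonos_and_cokernels

end Duality

section FlatComplexes

variable {k : Type u} [Field k] {A : Type u} [Ring A] [Algebra k A]

variable (k) in
/-- The functor `X ⊗_{Aᵉ} -` on chain complexes. -/
abbrev tensorComplex (X : Bimodule k A) :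
    ChainComplex (Bimodule k A) ℕ ⥤ ChainComplex (ModuleCat.{u} k) ℕ :=
  (tensorFunctor k X).mapHomologicalComplex (ComplexShape.down ℕ)

variable (k) in
/-- The natural transformation `X ⊗_{Aᵉ} - ⟶ Y ⊗_{Aᵉ} -` induced by `X → Y`. -/
def tensorFunctorMap {X Y : Bimodule k A} (f : X ⟶ Y) : tensorFunctor k X ⟶ tensorFunctor k Y where
  app P := ModuleCat.ofHom (BTensor.map k f (𝟙 P))
  naturality _ _ _ := ModuleCat.hom_ext <| BTensor.hom_ext k fun _ _ => rfl

/-- The sequence of complexes `X₁ ⊗_{Aᵉ} C → X₂ ⊗_{Aᵉ} C → X₃ ⊗_{Aᵉ} C` attached to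
`X₁ → X₂ → X₃`. -/
def tensorShortComplex (S : ShortComplex (Bimodule k A)) (C : ChainComplex (Bimodule k A) ℕ) :
    ShortComplex (ChainComplex (ModuleCat.{u} k) ℕ) where
  X₁ := (tensorComplex k S.X₁).obj C
  X₂ := (tensorComplex k S.X₂).obj C
  X₃ := (tensorComplex k S.X₃).obj C
  f := (NatTrans.mapHomologicalComplex (tensorFunctorMap k S.f) _).app C
  g := (NatTrans.mapHomologicalComplex (tensorFunctorMap k S.g) _).app C
  zero := by
    ext n : 1
    refine ModuleCat.hom_ext (BTensor.hom_ext k fun x p => ?_)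
    exact (congrArg (BTensor.mkₗ S.X₃ (C.X n) · p) (congrArg (fun f => f.hom x) S.zero)).trans
      (map_zero ((BTensor.mkₗ S.X₃ (C.X n)).flip p))

theorem shortExact_tensorShortComplex {S : ShortComplex (Bimodule k A)} (hS : S.ShortExact)
    {C : ChainComplex (Bimodule k A) ℕ} (hC : ∀ n, IsFlat k (C.X n)) :
    (tensorShortComplex S C).ShortExact := by
  refine shortExact_of_degreewise_shortExact _ fun n => ?_
  have := preservesHomology_tensorFunctor (hC n)
  have := (tensorFunctor k (C.X n)).preservesFiniteLimits_of_preservesHomology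
  have := (tensorFunctor k (C.X n)).preservesFiniteColimits_of_preservesHomology
  let e (X : Bimodule k A) := (BTensor.comm (C.X n) X).toModuleIso
  refine ShortComplex.shortExact_of_iso (ShortComplex.isoMk (e _) (e _) (e _) ?_ ?_)
    (hS.map_of_exact (tensorFunctor k (C.X n))) <;>
    exact ModuleCat.hom_ext <| BTensor.hom_ext k fun _ _ => rfl

/-- The map of sequences of complexes induced by a chain map. -/
def tensorShortComplexMap (S : ShortComplex (Bimodule k A)) {C D : ChainComplex (Bimodule k A) ℕ}
    (f : C ⟶ D) : tensorShortComplex S C ⟶ tensorShortComplex S D where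
  τ₁ := (tensorComplex k S.X₁).map f
  τ₂ := (tensorComplex k S.X₂).map f
  τ₃ := (tensorComplex k S.X₃).map f
  comm₁₂ := ((NatTrans.mapHomologicalComplex (tensorFunctorMap k S.f) _).naturality f)
  comm₂₃ := ((NatTrans.mapHomologicalComplex (tensorFunctorMap k S.g) _).naturality f)

theorem quasiIso_tensorComplex_map {C D : ChainComplex (Bimodule k A) ℕ}
    (hC : ∀ n, IsFlat k (C.X n)) (hD : ∀ n, IsFlat k (D.X n)) (f : C ⟶ D) [QuasiIso f]
    (X : Bimodule k A) : QuasiIso ((tensorComplex k X).map f) := by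
  have projective (L : Bimodule k A) [Projective L] : QuasiIso ((tensorComplex k L).map f) :=
    have := preservesHomology_tensorFunctor (isFlat_of_projective L)
    inferInstance
  -- Induction on the degree: dimension shifting in `X` along `0 → X' → L → X → 0`, `L` projective.
  suffices key : ∀ n X, IsIso (homologyMap ((tensorComplex k X).map f) n) from
    ⟨fun n => (quasiIsoAt_iff_isIso_homologyMap _ n).2 (key n X)⟩
  intro n
  induction n using Nat.strong_induction_on with
  | _ n ih =>
    have prev (X : Bimodule k A) (j : ℕ) (hj : (ComplexShape.down ℕ).Rel n j) :
        IsIso (homologyMap ((tensorComplex k X).map f) j) :=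
      ih j (by rw [ComplexShape.down_Rel] at hj; omega) X
    let S (X : Bimodule k A) := ShortComplex.mk _ _ (kernel.condition (Projective.π X))
    have hS (X : Bimodule k A) : (S X).ShortExact :=
      { exact := ShortComplex.exact_kernel _ }
    have h₁ (X : Bimodule k A) := shortExact_tensorShortComplex (hS X) hC
    have h₂ (X : Bimodule k A) := shortExact_tensorShortComplex (hS X) hD
    have mid (X : Bimodule k A) (i : ℕ) :
        IsIso (homologyMap (tensorShortComplexMap (S X) f).τ₂ i) :=
      have := projective (Projective.over X)
      inferInstanceAs (IsIso (homologyMap ((tensorComplex k (Projective.over X)).map f) i))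
    have epi (X : Bimodule k A) : Epi (homologyMap ((tensorComplex k X).map f) n) :=
      HomologySequence.epi_homologyMap_τ₃ (tensorShortComplexMap (S X) f) (h₁ X) (h₂ X) n
        inferInstance
        (fun j hj =>
          have : IsIso (homologyMap (tensorShortComplexMap (S X) f).τ₁ j) := prev _ j hj
          inferInstance)
        fun j _ => inferInstance
    exact fun X => HomologySequence.isIso_homologyMap_τ₃ (tensorShortComplexMap (S X) f)
      (h₁ X) (h₂ X) n (epi _) inferInstance (prev _) fun j _ => inferInstance

end FlatComplexes

section ChangeOfRings

variable {k : Type u} [Field k] {A : Type u} [Ring A] [Algebra k A] {R S T C : Type u} [Ring R]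
  [Algebra k R] [Ring S] [Algebra k S] [Ring T] [Algebra k T] [Ring C] [Algebra k C]

/-- Restriction of scalars along a homomorphism of `k`-algebras. -/
abbrev restrictAlong (f : S →ₐ[k] T) : ModuleCat.{u} T ⥤ ModuleCat.{u} S :=
  ModuleCat.restrictScalars f.toRingHom

/-- A homomorphism `f : S → T` for which restriction of scalars preserves injective modules;
equivalently, `T` is flat as a right `S`-module. -/
def PreservesInjectives (f : S →ₐ[k] T) : Prop :=
  (restrictAlong f).PreservesInjectiveObjects

/-- Restriction of scalars along a homomorphism of `k`-algebras does not change the underlying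
vector space. -/
def restrictScalarsEquiv (f : S →ₐ[k] T) (M : ModuleCat.{u} T) :
    M ≃ₗ[k] (restrictAlong f).obj M :=
  { AddEquiv.refl M with
    map_smul' := fun c m => (congrArg (· • m) (f.commutes c)).symm }

theorem PreservesInjectives.comp {f : R →ₐ[k] S} {g : S →ₐ[k] T} (hg : PreservesInjectives g)
    (hf : PreservesInjectives f) : PreservesInjectives (g.comp f) :=
  ⟨fun h => hf.injective_obj (hg.injective_obj h)⟩

theorem preservesInjectives_algEquiv (e : S ≃ₐ[k] T) :
    PreservesInjectives (e : S →ₐ[k] T) :=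
  Functor.preservesInjectiveObjects_of_isEquivalence
    (F := (ModuleCat.restrictScalarsEquivalenceOfRingEquiv e.toRingEquiv).functor)

/-- The map `ev : M → W` exhibits the `S`-module `M` as `Hom_k(S, W)`, an element `m` corresponding
to `s ↦ ev (s m)`. -/
def IsCofree {M : ModuleCat.{u} S} {W : ModuleCat.{u} k} (ev : M →ₗ[k] W) : Prop :=
  Function.Bijective fun m => ev ∘ₗ (LinearMap.toSpanSingleton S M m).restrictScalars k

namespace IsCofree

variable {M : ModuleCat.{u} S} {W : ModuleCat.{u} k} {ev : M →ₗ[k] W} (hM : IsCofree ev)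
include hM

theorem ext {m n : M} (h : ∀ s : S, ev (s • m) = ev (s • n)) : m = n :=
  hM.1 (LinearMap.ext h)

theorem exists_lift {V : ModuleCat.{u} S} (φ : V →ₗ[k] W) :
    ∃ f : V ⟶ M, ∀ v, ev (f.hom v) = φ v := by
  choose f hf using fun v : V => hM.2 (φ ∘ₗ (LinearMap.toSpanSingleton S V v).restrictScalars k)
  have key (s : S) (v : V) : ev (s • f v) = φ (s • v) := LinearMap.congr_fun (hf v) s
  refine ⟨ModuleCat.ofHom ⟨⟨f, fun v w => hM.ext fun s => ?_⟩, fun r v => hM.ext fun s => ?_⟩,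
    fun v => ?_⟩
  · simp only [key, smul_add, map_add]
  · simp only [key, RingHom.id_apply, smul_smul]
  · simpa using key 1 v

theorem injective : Injective M := by
  refine ⟨fun {V V'} g i _ => ?_⟩
  obtain ⟨r, hr⟩ := (i.hom.restrictScalars k).exists_leftInverse_of_injective
    (LinearMap.ker_eq_bot.2 ((ModuleCat.mono_iff_injective i).1 inferInstance))
  obtain ⟨f, hf⟩ := hM.exists_lift (ev ∘ₗ g.hom.restrictScalars k ∘ₗ r)
  refine ⟨f, ModuleCat.hom_ext <| LinearMap.ext fun v => hM.ext fun s => ?_⟩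
  have h : r (i.hom (s • v)) = s • v := LinearMap.congr_fun hr (s • v)
  change ev (s • f.hom (i.hom v)) = ev (s • g.hom v)
  rw [← map_smul, ← map_smul, hf, ← map_smul]
  exact congrArg (fun v => ev (g.hom v)) h

end IsCofree

variable (k A) in
/-- The evaluation at `1` of linear forms on `A`. -/
def evalOne (j : S →ₐ[k] Env k A) (W : ModuleCat.{u} k) :
    (restrictAlong j).obj (dual k (regular k A) W) →ₗ[k] W where
  toFun f := dual.equiv f (regular.of k 1)
  map_add' _ _ := rfl
  map_smul' c f := by
    change dual.equiv (j (algebraMap k S c) • f) _ = _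
    rw [AlgHom.commutes]
    exact LinearMap.congr_fun (dual.equiv_smul c f) _

theorem isCofree_evalOne (j : S →ₐ[k] Env k A) (W : ModuleCat.{u} k) (e : S ≃ₗ[k] A)
    (h : ∀ s (f : dual k (regular k A) W),
      dual.equiv (j s • f) (regular.of k 1) = dual.equiv f (regular.of k (e s))) :
    IsCofree (evalOne k A j W) := by
  have smul (c : k) (a : A) : c • regular.of k a = regular.of k (c • a) := by
    change AlgHom.mulLeftRight k A (algebraMap k (Env k A) c) a = c • a
    rw [AlgHom.commutes]
    rfl
  let ofₗ : A ≃ₗ[k] regular k A :=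
    { AddEquiv.refl A with toFun := regular.of k, map_smul' := fun c a => (smul c a).symm }
  have key : (fun m => evalOne k A j W ∘ₗ (LinearMap.toSpanSingleton S _ m).restrictScalars k) =
      fun m => dual.equiv m ∘ₗ (e.trans ofₗ).toLinearMap :=
    funext fun f => LinearMap.ext fun s => h s f
  rw [IsCofree, key]
  exact ((e.trans ofₗ).congrLeft W k).symm.bijective.comp dual.equiv.bijective

theorem isCofree_evalOne_includeLeft (W : ModuleCat.{u} k) :
    IsCofree (evalOne k A Algebra.TensorProduct.includeLeft W) :=
  isCofree_evalOne _ W (.refl k A) fun s f => by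
    refine (dual.equiv_act s 1 f _).trans ?_
    rw [regular_act, one_mul, one_mul]
    rfl

theorem isCofree_evalOne_includeRight (W : ModuleCat.{u} k) :
    IsCofree (evalOne k A Algebra.TensorProduct.includeRight W) :=
  isCofree_evalOne _ W (opLinearEquiv k).symm fun s f => by
    refine (dual.equiv_act 1 s.unop f _).trans ?_
    rw [regular_act, mul_one, mul_one]
    rfl

theorem preservesInjectives_of_isCofree (f : S →ₐ[k] T)
    (h : ∀ W : ModuleCat.{u} k, ∃ (M : ModuleCat.{u} T) (ev : M →ₗ[k] W), IsCofree ev ∧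
      Injective ((restrictAlong f).obj M)) :
    PreservesInjectives f := by
  refine ⟨fun {J} _ => ?_⟩
  obtain ⟨M, ev, hM, hinj⟩ := h (ModuleCat.of k J)
  obtain ⟨i, hi⟩ := hM.exists_lift (LinearMap.id : J →ₗ[k] J)
  have : Mono i := (ModuleCat.mono_iff_injective i).2 (Function.LeftInverse.injective hi)
  exact Retract.injective (Retract.map
    ⟨i, Injective.factorThru (𝟙 J) i, Injective.comp_factorThru (𝟙 J) i⟩ _)

theorem exists_isCofree (S : Type u) [Ring S] [Algebra k S] (W : ModuleCat.{u} k) :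
    ∃ (M : ModuleCat.{u} S) (ev : M →ₗ[k] W), IsCofree ev :=
  ⟨_, _, isCofree_evalOne_includeLeft W⟩

namespace IsCofree

variable {W : ModuleCat.{u} k} {M : ModuleCat.{u} (T ⊗[k] C)} {ev : M →ₗ[k] W}
  {N : ModuleCat.{u} T} {ev' : N →ₗ[k] W}

theorem exists_addMonoidHom (ev : M →ₗ[k] W) (hN : IsCofree ev') :
    ∃ p : M →+ N, (∀ (t : T) (m : M), p ((t ⊗ₜ[k] (1 : C)) • m) = t • p m) ∧
      ∀ (t : T) (c : C) (m : M), ev ((t ⊗ₜ[k] c) • m) = ev' (t • p (((1 : T) ⊗ₜ[k] c) • m)) := by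
  obtain ⟨p, hp⟩ := hN.exists_lift (V := (restrictAlong Algebra.TensorProduct.includeLeft).obj M)
    (ev ∘ₗ (restrictScalarsEquiv Algebra.TensorProduct.includeLeft M).symm.toLinearMap)
  let q : M →+ N := p.hom.toAddMonoidHom
  have hq : ∀ (t : T) (m : M), q ((t ⊗ₜ[k] (1 : C)) • m) = t • q m := map_smul p.hom
  have hev : ∀ m : M, ev' (q m) = ev m := hp
  refine ⟨q, hq, fun t c m => ?_⟩
  rw [← hq, hev, smul_smul]
  simp

theorem hom_ext (hM : IsCofree ev) {p : M →+ N}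
    (hp : ∀ (t : T) (c : C) (m : M), ev ((t ⊗ₜ[k] c) • m) = ev' (t • p (((1 : T) ⊗ₜ[k] c) • m)))
    {f : S →ₐ[k] T} {V : ModuleCat.{u} (S ⊗[k] C)}
    {g g' : V ⟶ (restrictAlong (Algebra.TensorProduct.map f (AlgHom.id k C))).obj M}
    (h : ∀ v, p (g.hom v) = p (g'.hom v)) : g = g' := by
  refine ModuleCat.hom_ext <| LinearMap.ext fun v => hM.1 <| TensorProduct.ext' fun t c => ?_
  have key (g : V ⟶ (restrictAlong (Algebra.TensorProduct.map f (AlgHom.id k C))).obj M) :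
      ((1 : T) ⊗ₜ[k] c) • (show M from g.hom v) = g.hom (((1 : S) ⊗ₜ[k] c) • v) := by
    refine .trans ?_ (map_smul g.hom ((1 : S) ⊗ₜ[k] c) v).symm
    exact congrArg (fun t : T => (t ⊗ₜ[k] c) • (show M from g.hom v)) (map_one f).symm
  refine (hp t c (g.hom v)).trans (.trans ?_ (hp t c (g'.hom v)).symm)
  exact congrArg (fun n => ev' (t • n))
    ((congrArg p (key g)).trans ((h _).trans (congrArg p (key g')).symm))

theorem exists_factor (hM : IsCofree ev) (hN : IsCofree ev') {p : M →+ N}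
    (hp : ∀ (t : T) (c : C) (m : M), ev ((t ⊗ₜ[k] c) • m) = ev' (t • p (((1 : T) ⊗ₜ[k] c) • m)))
    (f : S →ₐ[k] T) {V : ModuleCat.{u} (S ⊗[k] C)} (q : V →+ N)
    (hq : ∀ (s : S) (v : V), q ((s ⊗ₜ[k] (1 : C)) • v) = f s • q v) :
    ∃ g : V ⟶ (restrictAlong (Algebra.TensorProduct.map f (AlgHom.id k C))).obj M,
      ∀ v, p (g.hom v) = q v := by
  have hsmul (c : k) (v : V) : q (c • v) = c • q v := by
    have h := hq (algebraMap k S c) v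
    rwa [AlgHom.commutes, algebraMap_smul, ← Algebra.TensorProduct.algebraMap_apply,
      algebraMap_smul] at h
  have hψ (v : V) : ∃ m : M, ∀ (t : T) (c : C),
      ev ((t ⊗ₜ[k] c) • m) = ev' (t • q (((1 : S) ⊗ₜ[k] c) • v)) := by
    obtain ⟨m, hm⟩ := hM.2 (TensorProduct.lift (LinearMap.mk₂ k
      (fun t c => ev' (t • q (((1 : S) ⊗ₜ[k] c) • v))) (by simp [add_smul]) (by simp)
      (by simp [TensorProduct.tmul_add, add_smul]) (by simp [hsmul, smul_algebra_smul_comm])))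
    exact ⟨m, fun t c => LinearMap.congr_fun hm (t ⊗ₜ c)⟩
  choose G hG using hψ
  have hext {m n : M} (h : ∀ (t : T) (c : C), ev ((t ⊗ₜ[k] c) • m) = ev ((t ⊗ₜ[k] c) • n)) :
      m = n := hM.1 (TensorProduct.ext' h)
  have h_add (v w : V) : G (v + w) = G v + G w := hext fun t c => by
    simp only [hG, smul_add, map_add]
  have h_act (s : S) (c : C) (v : V) : G ((s ⊗ₜ[k] c) • v) = (f s ⊗ₜ[k] c) • G v :=
    hext fun t d => by
      have h : ((1 : S) ⊗ₜ[k] d) • (s ⊗ₜ[k] c) • v =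
          (s ⊗ₜ[k] (1 : C)) • ((1 : S) ⊗ₜ[k] (d * c)) • v := by
        simp [smul_smul]
      rw [smul_smul, Algebra.TensorProduct.tmul_mul_tmul, hG, hG, h, hq, smul_smul]
  have h_smul (r : S ⊗[k] C) (v : V) :
      G (r • v) = Algebra.TensorProduct.map f (AlgHom.id k C) r • G v := by
    induction r with
    | zero => simpa using h_act 0 0 v
    | tmul s c => exact h_act s c v
    | add r r' h h' => rw [add_smul, h_add, h, h', map_add, add_smul]
  let φ := Algebra.TensorProduct.map f (AlgHom.id k C)
  refine ⟨ModuleCat.ofHom (Y := (restrictAlong φ).obj M)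
    { toFun := G, map_add' := h_add, map_smul' := h_smul }, fun v => hN.ext fun t => ?_⟩
  have h := (hp t 1 (G v)).symm.trans (hG v t 1)
  rwa [← Algebra.TensorProduct.one_def, ← Algebra.TensorProduct.one_def, one_smul, one_smul] at h

theorem injective_restrictAlong_map_id (hM : IsCofree ev) (hN : IsCofree ev') (f : S →ₐ[k] T)
    [Injective ((restrictAlong f).obj N)] :
    Injective ((restrictAlong (Algebra.TensorProduct.map f (AlgHom.id k C))).obj M) := by
  obtain ⟨p, hp, hev⟩ := hN.exists_addMonoidHom ev
  refine ⟨fun {V V'} g i _ => ?_⟩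
  let left := restrictAlong (Algebra.TensorProduct.includeLeft : S →ₐ[k] S ⊗[k] C)
  let g₀ : left.obj V ⟶ (restrictAlong f).obj N :=
    ModuleCat.ofHom (X := left.obj V) (Y := (restrictAlong f).obj N)
      { toFun := fun v => p (g.hom v)
        map_add' := fun v w => (congrArg p (map_add g.hom v w)).trans (map_add p _ _)
        map_smul' := fun s v => by
          refine (congrArg p (map_smul g.hom (s ⊗ₜ[k] (1 : C)) v)).trans (hp (f s) _) }
  let g₁ := Injective.factorThru g₀ (left.map i)
  obtain ⟨g', hg'⟩ := exists_factor hM hN hev f g₁.hom.toAddMonoidHom (map_smul g₁.hom)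
  refine ⟨g', hom_ext hM hev fun v => (hg' (i.hom v)).trans ?_⟩
  exact congrArg (fun h => h.hom v) (Injective.comp_factorThru g₀ (left.map i))

end IsCofree

theorem PreservesInjectives.map_id {f : S →ₐ[k] T} (hf : PreservesInjectives f) :
    PreservesInjectives (Algebra.TensorProduct.map f (AlgHom.id k C)) := by
  refine preservesInjectives_of_isCofree _ fun W => ?_
  obtain ⟨M, ev, hM⟩ := exists_isCofree (T ⊗[k] C) W
  obtain ⟨N, ev', hN⟩ := exists_isCofree T W
  have : Injective N := hN.injective
  have : Injective ((restrictAlong f).obj N) := hf.injective_obj inferInstance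
  exact ⟨M, ev, hM, hM.injective_restrictAlong_map_id hN f⟩

theorem PreservesInjectives.id_map {f : S →ₐ[k] T} (hf : PreservesInjectives f) :
    PreservesInjectives (Algebra.TensorProduct.map (AlgHom.id k C) f) := by
  have h : Algebra.TensorProduct.map (AlgHom.id k C) f =
      ((Algebra.TensorProduct.comm k T C : T ⊗[k] C →ₐ[k] C ⊗[k] T).comp
        (Algebra.TensorProduct.map f (AlgHom.id k C))).comp
      (Algebra.TensorProduct.comm k C S : C ⊗[k] S →ₐ[k] S ⊗[k] C) := by
    ext <;> simp
  rw [h]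
  exact ((preservesInjectives_algEquiv _).comp hf.map_id).comp (preservesInjectives_algEquiv _)

theorem PreservesInjectives.map {R' S' : Type u} [Ring R'] [Algebra k R'] [Ring S'] [Algebra k S']
    {f : R →ₐ[k] S} {g : R' →ₐ[k] S'} (hf : PreservesInjectives f) (hg : PreservesInjectives g) :
    PreservesInjectives (Algebra.TensorProduct.map f g) := by
  rw [← AlgHom.comp_id f, ← AlgHom.id_comp g, Algebra.TensorProduct.map_comp]
  exact hf.map_id.comp hg.id_map

theorem preservesInjectives_ofId : PreservesInjectives (Algebra.ofId k S) :=
  ⟨fun _ => inferInstance⟩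

theorem preservesInjectives_includeLeft :
    PreservesInjectives (Algebra.TensorProduct.includeLeft : S →ₐ[k] S ⊗[k] C) := by
  have h : (Algebra.TensorProduct.includeLeft : S →ₐ[k] S ⊗[k] C) =
      (Algebra.TensorProduct.map (AlgHom.id k S) (Algebra.ofId k C)).comp
        (Algebra.TensorProduct.rid k k S).symm := by
    ext; simp
  rw [h]
  exact preservesInjectives_ofId.id_map.comp (preservesInjectives_algEquiv _)

theorem preservesInjectives_includeRight :
    PreservesInjectives (Algebra.TensorProduct.includeRight : C →ₐ[k] S ⊗[k] C) := by
  have h : (Algebra.TensorProduct.includeRight : C →ₐ[k] S ⊗[k] C) =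
      (Algebra.TensorProduct.map (Algebra.ofId k S) (AlgHom.id k C)).comp
        (Algebra.TensorProduct.lid k C).symm := by
    ext; simp
  rw [h]
  exact preservesInjectives_ofId.map_id.comp (preservesInjectives_algEquiv _)

end ChangeOfRings

section FlatExtension

variable {k : Type u} [Field k] {A : Type u} [Ring A] [Algebra k A]

/-- The sequence `Hom_k(S₃, W) → Hom_k(S₂, W) → Hom_k(S₁, W)` attached to `S₁ → S₂ → S₃`. -/
def dualShortComplex (S : ShortComplex (Bimodule k A)) (W : ModuleCat.{u} k) :
    ShortComplex (Bimodule k A) where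
  X₁ := dual k S.X₃ W
  X₂ := dual k S.X₂ W
  X₃ := dual k S.X₁ W
  f := dualMap S.g (𝟙 W)
  g := dualMap S.f (𝟙 W)
  zero := dual.hom_ext fun f x =>
    (congrArg (fun h => dual.equiv f (h.hom x)) S.zero).trans (map_zero (dual.equiv f))

theorem shortExact_dualShortComplex {S : ShortComplex (Bimodule k A)} (hS : S.ShortExact)
    (W : ModuleCat.{u} k) : (dualShortComplex S W).ShortExact := by
  have hg := hS.moduleCat_surjective_g
  have := hS.mono_f
  refine { exact := ?_, mono_f := ?_, epi_g := epi_dualMap S.f W }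
  · obtain ⟨s, hs⟩ := (S.g.hom.restrictScalars k).exists_rightInverse_of_surjective
      (LinearMap.range_eq_top.2 hg)
    refine (ShortComplex.moduleCat_exact_iff _).2 fun h hh =>
      ⟨dual.equiv.symm (dual.equiv h ∘ₗ s), dual.equiv.injective <| LinearMap.ext fun x => ?_⟩
    have hx : S.g.hom (s (S.g.hom x) - x) = 0 :=
      (map_sub S.g.hom _ _).trans (sub_eq_zero.2 (LinearMap.congr_fun hs (S.g.hom x)))
    obtain ⟨y, hy⟩ := (ShortComplex.moduleCat_exact_iff _).1 hS.exact _ hx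
    have hy₀ : dual.equiv h (S.f.hom y) = 0 := congrArg (fun h' => dual.equiv h' y) hh
    rw [hy, map_sub, sub_eq_zero] at hy₀
    exact hy₀
  · refine (ModuleCat.mono_iff_injective _).2 fun h h' hh =>
      dual.equiv.injective <| LinearMap.ext fun x => ?_
    obtain ⟨y, rfl⟩ := hg x
    exact congrArg (fun h => dual.equiv h y) hh

theorem injective_of_shortExact {C : Type*} [Category* C] [Abelian C] {S : ShortComplex C}
    (hS : S.ShortExact) (_ : Injective S.X₁) (_ : Injective S.X₃) : Injective S.X₂ :=
  Injective.of_iso hS.splittingOfInjective.isoBinaryBiproduct.symm inferInstance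

instance {R S : Type u} [Ring R] [Ring S] (f : R →+* S) :
    PreservesLimits (ModuleCat.restrictScalars.{u} f) :=
  ⟨⟨inferInstance⟩⟩

instance {R S : Type u} [Ring R] [Ring S] (f : R →+* S) :
    PreservesColimits (ModuleCat.restrictScalars.{u} f) :=
  ⟨⟨inferInstance⟩⟩

variable (B : Subalgebra k A)

/-- Restricting `Hom_k(P, W)` to `B` is the same as restricting `P`. -/
def dualResIso (P : Bimodule k A) (W : ModuleCat.{u} k) :
    dual k ((res B).obj P) W ≅ (res B).obj (dual k P W) :=
  let e : dual k ((res B).obj P) W ≃+ (res B).obj (dual k P W) :=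
    dual.equiv.trans ((restrictScalarsEquiv (envIncl B) P).symm.congrLeft W k).toAddEquiv
  (e.toLinearEquiv <| map_smul_of_act k e.toAddMonoidHom fun a b f =>
    dual.equiv.injective <| LinearMap.ext fun p => (dual.equiv_act a b f p).trans
      (dual.equiv_act (a : A) (b : A) (e f : dual k P W) p).symm).toModuleIso

/-- The sequence `B → A → A/B` of `B`-bimodules. -/
def inclShortComplex : ShortComplex (Bimodule k B) where
  X₁ := regular k B
  X₂ := (res B).obj (regular k A)
  X₃ := quotBimod B
  f := inclBimod B
  g := ModuleCat.ofHom (X := (res B).obj (regular k A)) (Y := quotBimod B)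
    (LinearMap.range (inclBimod B).hom).mkQ
  zero := ModuleCat.hom_ext <| LinearMap.range_mkQ_comp _

theorem shortExact_inclShortComplex : (inclShortComplex B).ShortExact where
  exact := (ShortComplex.moduleCat_exact_iff _).2 fun _ h =>
    (Submodule.Quotient.mk_eq_zero (LinearMap.range (inclBimod B).hom)).1 h
  mono_f := (ModuleCat.mono_iff_injective (inclBimod B)).2 Subtype.val_injective
  epi_g := (ModuleCat.epi_iff_surjective (inclShortComplex B).g).2
    (LinearMap.range (inclBimod B).hom).mkQ_surjective

variable {B} {S : Type u} [Ring S] [Algebra k S]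

theorem injective_restrictAlong_dual_res (hB : IsFlat k (quotBimod B)) {j : S →ₐ[k] Env k B}
    (hj : PreservesInjectives j) (W : ModuleCat.{u} k)
    (hW : Injective ((restrictAlong j).obj (dual k (regular k B) W))) :
    Injective ((restrictAlong j).obj ((res B).obj (dual k (regular k A) W))) := by
  have : Injective (dual k (quotBimod B) W) := isFlat_iff_injective_dual.1 hB W
  have hS := shortExact_dualShortComplex (shortExact_inclShortComplex B) W
  exact Injective.of_iso ((restrictAlong j).mapIso (dualResIso B (regular k A) W)) <|
    injective_of_shortExact (hS.map_of_exact (restrictAlong j)) (hj.injective_obj this) hW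

theorem preservesInjectives_val (hB : IsFlat k (quotBimod B)) : PreservesInjectives B.val :=
  preservesInjectives_of_isCofree _ fun W =>
    ⟨_, _, isCofree_evalOne_includeLeft W, injective_restrictAlong_dual_res hB
      preservesInjectives_includeLeft W (isCofree_evalOne_includeLeft W).injective⟩

theorem preservesInjectives_op_val (hB : IsFlat k (quotBimod B)) :
    PreservesInjectives (AlgHom.op B.val) :=
  preservesInjectives_of_isCofree _ fun W =>
    ⟨_, _, isCofree_evalOne_includeRight W, injective_restrictAlong_dual_res hB
      preservesInjectives_includeRight W (isCofree_evalOne_includeRight W).injective⟩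

theorem preservesInjectiveObjects_res (hB : IsFlat k (quotBimod B)) :
    (res B).PreservesInjectiveObjects :=
  (preservesInjectives_val hB).map (preservesInjectives_op_val hB)

theorem isFlat_res (hB : IsFlat k (quotBimod B)) {P : Bimodule k A} (hP : IsFlat k P) :
    IsFlat k ((res B).obj P) :=
  isFlat_iff_injective_dual.2 fun W =>
    have := isFlat_iff_injective_dual.1 hP W
    Injective.of_iso (dualResIso B P W).symm
      ((preservesInjectiveObjects_res hB).injective_obj inferInstance)

end FlatExtension

section Induction

variable {k : Type u} [Field k] {A : Type u} [Ring A] [Algebra k A] (B : Subalgebra k A)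

instance : (res B).IsRightAdjoint :=
  isRightAdjoint_of_preservesLimits_of_isCoseparating
    (isCoseparator_coseparator (Bimodule k A)) (res B)

/-- Induction of bimodules from `B` to `A`, that is `M ↦ A ⊗_B M ⊗_B A`. -/
def ind : Bimodule k B ⥤ Bimodule k A := (res B).leftAdjoint

/-- Frobenius reciprocity for bimodules. -/
def indAdj : ind B ⊣ res B := .ofIsRightAdjoint (res B)

instance : (ind B).Additive := (indAdj B).left_adjoint_additive

variable {B}

theorem preservesHomology_ind (hB : IsFlat k (quotBimod B)) : (ind B).PreservesHomology := by
  have := preservesInjectiveObjects_res hB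
  have := Functor.preservesMonomorphisms_of_adjunction_of_preservesInjectiveObjects (indAdj B)
  have := (indAdj B).leftAdjoint_preservesColimits
  exact (ind B).preservesHomology_of_preservesMonos_and_cokernels

theorem isRelProjective_ind (V : Bimodule k B) : IsRelProjective B ((ind B).obj V) :=
  fun M N g s hs f =>
    ⟨((indAdj B).homEquiv _ _).symm ((indAdj B).homEquiv _ _ f ≫ s),
      ((indAdj B).homEquiv _ _).injective <| by
        rw [Adjunction.homEquiv_naturality_right, Equiv.apply_symm_apply, Category.assoc, hs,
          Category.comp_id]⟩

theorem IsRelProjective.exists_lift {P M N : Bimodule k A} (hP : IsRelProjective B P) (g : M ⟶ N)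
    (f : P ⟶ N) (s : (res B).obj P ⟶ (res B).obj M) (hs : s ≫ (res B).map g = (res B).map f) :
    ∃ h : P ⟶ M, h ≫ g = f := by
  obtain ⟨t, ht⟩ := hP _ _ ((indAdj B).counit.app P) ((indAdj B).unit.app ((res B).obj P))
    ((indAdj B).right_triangle_components P) (𝟙 P)
  refine ⟨t ≫ ((indAdj B).homEquiv _ _).symm s, ?_⟩
  rw [Category.assoc, ← Adjunction.homEquiv_naturality_right_symm, hs,
    Adjunction.homEquiv_counit, Adjunction.counit_naturality, reassoc_of% ht]

theorem RelResolution.homExact {Y P : Bimodule k A} (R : RelResolution B Y)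
    (hP : IsRelProjective B P) : HomExact P R.complex R.aug := by
  obtain ⟨s', s, h, h₀, hs⟩ := R.contractible
  refine ⟨fun f => hP.exists_lift _ _ ((res B).map f ≫ s') ?_,
    fun f hf => hP.exists_lift _ _ ((res B).map f ≫ s 0) ?_,
    fun n f hf => hP.exists_lift _ _ ((res B).map f ≫ s (n + 1)) ?_⟩
  · rw [Category.assoc, h, Category.comp_id]
  · simpa [← Functor.map_comp_assoc, hf] using (res B).map f ≫= h₀
  · simpa [← Functor.map_comp_assoc, hf] using (res B).map f ≫= hs n

theorem isFlat_ind {V : Bimodule k B} (hV : IsFlat k V) : IsFlat k ((ind B).obj V) :=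
  isFlat_iff_exists_factor.2 fun {X Y} f _ W g => by
    let adj := (indAdj B).homEquiv V
    obtain ⟨g', hg'⟩ := isFlat_iff_exists_factor.1 hV ((res B).map f) W
      (adj _ g ≫ (dualResIso B X W).inv)
    refine ⟨(adj _).symm (g' ≫ (dualResIso B Y W).hom), (adj _).injective ?_⟩
    rw [Adjunction.homEquiv_naturality_right, Equiv.apply_symm_apply, Category.assoc,
      ← Iso.cancel_iso_inv_right _ _ (dualResIso B X W), ← hg', Category.assoc]
    rfl

end Induction

section Splice

variable {C D : Type*} [Category* C] [Category* D] [Preadditive C] [Preadditive D]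

theorem exists_homotopy_of_splitting (F : C ⥤ D) {K : ChainComplex C ℕ} {N : ℕ → C}
    {i : ∀ n, N n ⟶ K.X n} {p : ∀ n, K.X (n + 1) ⟶ N n} (hd : ∀ n, K.d (n + 1) n = p n ≫ i n)
    {r : ∀ n, F.obj (K.X n) ⟶ F.obj (N n)} {u : ∀ n, F.obj (N n) ⟶ F.obj (K.X (n + 1))}
    (hr : ∀ n, F.map (i n) ≫ r n = 𝟙 _) (hu : ∀ n, u n ≫ F.map (p n) = 𝟙 _)
    (hru : ∀ n, F.map (p n) ≫ u n + r (n + 1) ≫ F.map (i (n + 1)) = 𝟙 _) :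
    ∃ s : ∀ n, F.obj (K.X n) ⟶ F.obj (K.X (n + 1)), s 0 ≫ F.map (K.d 1 0) = r 0 ≫ F.map (i 0) ∧
      ∀ n, F.map (K.d (n + 1) n) ≫ s n + s (n + 1) ≫ F.map (K.d (n + 2) (n + 1)) = 𝟙 _ := by
  refine ⟨fun n => r n ≫ u n, ?_, fun n => ?_⟩
  · rw [hd, F.map_comp, Category.assoc, reassoc_of% hu]
  · rw [hd, hd, F.map_comp, F.map_comp, Category.assoc, Category.assoc, reassoc_of% hu,
      reassoc_of% hr]
    exact hru n

end Splice

section RelativeResolution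

variable {k : Type u} [Field k] {A : Type u} [Ring A] [Algebra k A] {B : Subalgebra k A}
  {M Y : Bimodule k A}

theorem exists_retraction_kernel (g : M ⟶ Y) {s : (res B).obj Y ⟶ (res B).obj M}
    (hs : s ≫ (res B).map g = 𝟙 _) :
    ∃ r : (res B).obj M ⟶ (res B).obj (kernel g), (res B).map (kernel.ι g) ≫ r = 𝟙 _ ∧
      (res B).map g ≫ s + r ≫ (res B).map (kernel.ι g) = 𝟙 _ := by
  have hS : (ShortComplex.mk (kernel.ι g) g (kernel.condition g)).Exact :=
    ShortComplex.exact_of_f_is_kernel _ (kernelIsKernel g)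
  let σ := ShortComplex.Splitting.ofExactOfSection _ (hS.map (res B)) s hs
    (inferInstanceAs (Mono ((res B).map (kernel.ι g))))
  exact ⟨σ.r, σ.f_r, (add_comm _ _).trans σ.id⟩

variable (B) in
/-- The syzygies of the relative resolution starting with `g : M → Y`. -/
def relSyzygy (g : M ⟶ Y) : ℕ → Bimodule k A
  | 0 => kernel g
  | n + 1 => kernel ((indAdj B).counit.app (relSyzygy g n))

variable (B) in
/-- The terms of the relative resolution starting with `g : M → Y`. -/
def relTerm (g : M ⟶ Y) : ℕ → Bimodule k A
  | 0 => M
  | n + 1 => (ind B).obj ((res B).obj (relSyzygy B g n))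

variable (B) in
/-- The inclusion of the syzygies into the terms of the relative resolution. -/
def relSyzygyι (g : M ⟶ Y) : ∀ n, relSyzygy B g n ⟶ relTerm B g n
  | 0 => kernel.ι g
  | n + 1 => kernel.ι ((indAdj B).counit.app (relSyzygy B g n))

variable (B) in
/-- The covers of the syzygies by the terms of the relative resolution. -/
def relCover (g : M ⟶ Y) (n : ℕ) : relTerm B g (n + 1) ⟶ relSyzygy B g n :=
  (indAdj B).counit.app (relSyzygy B g n)

theorem relSyzygyι_relCover (g : M ⟶ Y) (n : ℕ) : relSyzygyι B g (n + 1) ≫ relCover B g n = 0 :=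
  kernel.condition _

variable (B) in
/-- The complex of the terms of the relative resolution starting with `g : M → Y`. -/
def relComplex (g : M ⟶ Y) : ChainComplex (Bimodule k A) ℕ :=
  .of (relTerm B g) (fun n => relCover B g n ≫ relSyzygyι B g n) fun n => by
    rw [Category.assoc, reassoc_of% relSyzygyι_relCover, zero_comp, comp_zero]

theorem relComplex_d (g : M ⟶ Y) (n : ℕ) :
    (relComplex B g).d (n + 1) n = relCover B g n ≫ relSyzygyι B g n :=
  ChainComplex.of_d (relTerm B g) (fun n => relCover B g n ≫ relSyzygyι B g n) n

/-- The relative resolution of `Y` which starts with `g : M → Y` and then covers each kernel `N` by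
`A ⊗_B N ⊗_B A`. -/
def relResolution (g : M ⟶ Y) (hM : IsRelProjective B M)
    (hg : ∃ s : (res B).obj Y ⟶ (res B).obj M, s ≫ (res B).map g = 𝟙 _) : RelResolution B Y where
  complex := relComplex B g
  aug := g
  relProjective
    | 0 => hM
    | n + 1 => isRelProjective_ind _
  d_comp_aug := (congrArg (· ≫ g) (relComplex_d g 0)).trans <| (Category.assoc ..).trans <|
    (congrArg _ (kernel.condition g)).trans comp_zero
  contractible := by
    obtain ⟨s, hs⟩ := hg
    obtain ⟨r₀, hr₀, h₀⟩ := exists_retraction_kernel g hs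
    choose r hr h using fun n => exists_retraction_kernel (relCover B g n)
      ((indAdj B).right_triangle_components (relSyzygy B g n))
    let r' : ∀ n, (res B).obj (relTerm B g n) ⟶ (res B).obj (relSyzygy B g n)
      | 0 => r₀
      | n + 1 => r n
    obtain ⟨t, ht₀, ht⟩ := exists_homotopy_of_splitting (res B) (relComplex_d g) (r := r')
      (u := fun n => (indAdj B).unit.app _) (fun | 0 => hr₀ | n + 1 => hr n)
      (fun n => (indAdj B).right_triangle_components _) h
    exact ⟨s, t, hs, (congrArg _ ht₀).trans h₀, ht⟩

theorem isFlat_res_relSyzygy (hB : IsFlat k (quotBimod B)) {g : M ⟶ Y}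
    (hg : IsFlat k ((res B).obj (kernel g))) : ∀ n, IsFlat k ((res B).obj (relSyzygy B g n))
  | 0 => hg
  | n + 1 => by
    obtain ⟨r, hr, -⟩ := exists_retraction_kernel _
      ((indAdj B).right_triangle_components (relSyzygy B g n))
    exact IsFlat.of_retract ⟨_, r, hr⟩
      (isFlat_res hB (isFlat_ind (isFlat_res_relSyzygy hB hg n)))

theorem isFlat_relTerm_succ (hB : IsFlat k (quotBimod B)) {g : M ⟶ Y}
    (hg : IsFlat k ((res B).obj (kernel g))) (n : ℕ) : IsFlat k (relTerm B g (n + 1)) :=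
  isFlat_ind (isFlat_res_relSyzygy hB hg n)

end RelativeResolution

section RegularInduction

variable {k : Type u} [Field k] {A : Type u} [Ring A] [Algebra k A] {B : Subalgebra k A}

theorem act_act {X : Bimodule k A} (a b c d : A) (x : X) :
    act k a b (act k c d x) = act k (a * c) (d * b) x := by
  simp [act, smul_smul]

theorem regular_hom_ext {Y : Bimodule k A} {f g : regular k A ⟶ Y}
    (h : f.hom (regular.of k 1) = g.hom (regular.of k 1)) : f = g := by
  ext x
  have hx : act k (show A from x) 1 (regular.of k 1) = x :=
    (regular_act k (show A from x) 1 1).trans (by rw [mul_one, mul_one]; rfl)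
  rw [← hx]
  exact (map_smul f.hom _ _).trans ((congrArg _ h).trans (map_smul g.hom _ _).symm)

variable (B) in
/-- The elements of an `A`-bimodule that commute with `B`. -/
def CommutesWith {Y : Bimodule k A} (y : Y) : Prop :=
  ∀ b : B, act k (b : A) 1 y = act k 1 (b : A) y

theorem CommutesWith.act_mul_left {Y : Bimodule k A} {y : Y} (hy : CommutesWith B y) (a c : A)
    (b : B) : act k (a * b) c y = act k a (b * c) y := by
  simpa only [act_act, one_mul, mul_one] using congrArg (act k a c) (hy b)

/-- The map `f : A → Y` with `f (b a b') = b (f a) b'`, as a map of `B`-bimodules. -/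
def regularResHom {Y : Bimodule k A} (f : A →+ Y)
    (hf : ∀ (b b' : B) (a : A), f (b * a * b') = act k (b : A) (b' : A) (f a)) :
    (res B).obj (regular k A) ⟶ (res B).obj Y :=
  let g : (res B).obj (regular k A) →+ (res B).obj Y := f
  bimoduleHom g fun b b' a =>
    (congrArg g (regular_act (k := k) (b : A) (b' : A) (show A from a))).trans (hf b b' a)

/-- The map `a ↦ a y` of `B`-bimodules given by an element `y` commuting with `B`. -/
def CommutesWith.mulRight {Y : Bimodule k A} {y : Y} (hy : CommutesWith B y) :
    (res B).obj (regular k A) ⟶ (res B).obj Y :=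
  regularResHom
    (AddMonoidHom.mk' (fun a => act k a 1 y) fun a a' => by
      rw [← add_smul, ← TensorProduct.add_tmul])
    fun b b' a => by simp [act_act, hy.act_mul_left]

/-- The map `a ↦ y a` of `B`-bimodules given by an element `y` commuting with `B`. -/
def CommutesWith.mulLeft {Y : Bimodule k A} {y : Y} (hy : CommutesWith B y) :
    (res B).obj (regular k A) ⟶ (res B).obj Y :=
  regularResHom
    (AddMonoidHom.mk' (fun a => act k 1 a y) fun a a' => by
      rw [← add_smul, ← TensorProduct.tmul_add, ← MulOpposite.op_add])
    fun b b' a => by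
      have := hy.act_mul_left 1 (a * b') b
      rw [one_mul] at this
      simp [act_act, this, mul_assoc]

variable (k B) in
/-- The generator `1 ⊗ 1` of `A ⊗_B A`, the bimodule induced from `B`. -/
def indGen : (ind B).obj (regular k B) :=
  ((indAdj B).unit.app (regular k B)).hom (regular.of k 1)

variable (k B) in
theorem commutesWith_indGen : CommutesWith B (indGen k B) := fun b => by
  let f := ((indAdj B).unit.app (regular k B)).hom
  have h (c d : B) : f (regular.of k (c * 1 * d)) = act k (c : A) (d : A) (indGen k B) :=
    (congrArg f (regular_act k c d 1).symm).trans (map_smul f (c ⊗ₜ[k] op d : Env k B) _)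
  exact (h b 1).symm.trans ((congrArg (f <| regular.of k ·) (by simp)).trans (h 1 b))

variable (k B) in
theorem span_indGen : Submodule.span (Env k A) {indGen k B} = ⊤ := by
  let q := ModuleCat.ofHom (Submodule.span (Env k A) {indGen k B}).mkQ
  have hq : q = 0 := ((indAdj B).homEquiv _ _).injective <| regular_hom_ext <| by
    exact (Submodule.Quotient.mk_eq_zero _).2 (Submodule.mem_span_singleton_self _)
  rw [← Submodule.ker_mkQ (Submodule.span (Env k A) {indGen k B}), LinearMap.ker_eq_top]
  exact congrArg ModuleCat.Hom.hom hq

theorem ind_regular_addHom_ext {T : Type*} [AddCommMonoid T] {f g : (ind B).obj (regular k B) →+ T}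
    (h : ∀ a a', f (act k a a' (indGen k B)) = g (act k a a' (indGen k B))) : f = g := by
  ext x
  obtain ⟨r, rfl⟩ := Submodule.mem_span_singleton.1
    ((span_indGen k B).symm ▸ Submodule.mem_top : x ∈ Submodule.span (Env k A) {indGen k B})
  let e := (LinearMap.toSpanSingleton (Env k A) _ (indGen k B)).toAddMonoidHom
  change f.comp e r = g.comp e r
  induction r using TensorProduct.induction_on with
  | zero => exact (map_zero (f.comp e)).trans (map_zero (g.comp e)).symm
  | tmul a b => exact h a b.unop
  | add r s hr hs => rw [map_add, map_add, hr, hs]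

/-- The map `A ⊗_B A → Y` of bimodules given by an element of `Y` commuting with `B`. -/
def CommutesWith.indHom {Y : Bimodule k A} {y : Y} (hy : CommutesWith B y) :
    (ind B).obj (regular k B) ⟶ Y :=
  ((indAdj B).homEquiv _ _).symm (inclBimod B ≫ hy.mulRight)

theorem CommutesWith.indHom_indGen {Y : Bimodule k A} {y : Y} (hy : CommutesWith B y) :
    hy.indHom.hom (indGen k B) = y := by
  have h := ((indAdj B).homEquiv_unit (f := hy.indHom)).symm.trans (Equiv.apply_symm_apply _ _)
  exact (congrArg (fun f => f.hom (regular.of k 1)) h).trans (by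
    exact one_smul (Env k A) y)

theorem exists_ind_regular_map {T : Bimodule k A} (h : A →ₗ[k] T)
    (hh : ∀ (b : B) (a : A), h (b * a) = act k (b : A) 1 (h a)) :
    ∃ q : (ind B).obj (regular k B) →+ T,
      ∀ a a', q (act k a a' (indGen k B)) = act k a 1 (h a') := by
  let i := (Algebra.TensorProduct.includeLeft : A →ₐ[k] Env k A).toRingHom
  let V := (ModuleCat.restrictScalars i).obj T
  let ψ : Env k A →ₗ[k] T := TensorProduct.lift <|
    ((Algebra.lsmul k k T).toLinearMap ∘ₗ
      (Algebra.TensorProduct.includeLeft : A →ₐ[k] Env k A).toLinearMap).compl₂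
        (h ∘ₗ (opLinearEquiv k).symm.toLinearMap)
  have hψ (a : A) (x : Env k A) : ψ (a ⊗ₜ 1 * x) = act k a 1 (ψ x) := by
    induction x using TensorProduct.induction_on with
    | zero => simp
    | tmul c d => simp [ψ, smul_smul]
    | add x y hx hy => rw [mul_add, map_add, map_add, hx, hy]; exact (smul_add _ _ _).symm
  let φ : (ModuleCat.coextendScalars i).obj V := (ModuleCat.CoextendScalars.equiv i V).symm
    { toFun := ψ, map_add' := map_add ψ, map_smul' := hψ }
  have hφ : CommutesWith B φ := fun b => by
    refine ModuleCat.CoextendScalars.ext (LinearMap.ext fun (x : Env k A) => ?_)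
    change ψ (x * (b : A) ⊗ₜ 1) = ψ (x * 1 ⊗ₜ op (b : A))
    induction x using TensorProduct.induction_on with
    | zero => simp
    | tmul c d => simp [ψ, hh, smul_smul]
    | add x y hx hy => rw [add_mul, add_mul, map_add, map_add, hx, hy]
  let q := ((ModuleCat.restrictCoextendScalarsAdj i).homEquiv _ V).symm hφ.indHom
  refine ⟨q.hom.toAddMonoidHom, fun a a' => ?_⟩
  have hq : hφ.indHom.hom (act k a a' (indGen k B)) = act k a a' φ :=
    (map_smul _ _ _).trans (congrArg _ hφ.indHom_indGen)
  change ModuleCat.CoextendScalars.equiv i V (hφ.indHom.hom (act k a a' (indGen k B)))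
    (1 : Env k A) = _
  rw [hq]
  change ψ (1 * a ⊗ₜ op a') = _
  rw [one_mul]
  rfl

end RegularInduction

section IndRegularKernel

variable {k : Type u} [Field k] {A : Type u} [Ring A] [Algebra k A] {B : Subalgebra k A}

variable (k B) in
/-- The multiplication map `A ⊗_B A → A`. -/
def indMul : (ind B).obj (regular k B) ⟶ regular k A :=
  ((indAdj B).homEquiv _ _).symm (inclBimod B)

variable (k B) in
theorem indMul_act (a a' : A) :
    (indMul k B).hom (act k a a' (indGen k B)) = regular.of k (a * a') := by
  have h := ((indAdj B).homEquiv_unit (f := indMul k B)).symm.trans (Equiv.apply_symm_apply _ _)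
  have h₁ : (indMul k B).hom (indGen k B) = regular.of k 1 :=
    congrArg (fun f => f.hom (regular.of k 1)) h
  refine (map_smul _ _ _).trans ((congrArg _ h₁).trans ?_)
  exact (regular_act k a a' 1).trans (by rw [mul_one])

variable (k B) in
theorem mulRight_indMul :
    (commutesWith_indGen k B).mulRight ≫ (res B).map (indMul k B) = 𝟙 _ := by
  ext a
  exact (indMul_act k B (show A from a) 1).trans (congrArg _ (mul_one _))

variable (k B) in
theorem mulLeft_indMul :
    (commutesWith_indGen k B).mulLeft ≫ (res B).map (indMul k B) = 𝟙 _ := by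
  ext a
  exact (indMul_act k B 1 (show A from a)).trans (congrArg _ (one_mul _))

variable (k B) in
/-- The projection `A → A / B`. -/
def quotProj : (res B).obj (regular k A) ⟶ quotBimod B := (inclShortComplex B).g

instance : Epi (quotProj k B) := (shortExact_inclShortComplex B).epi_g

variable (k B) in
/-- The map `a ↦ 1 ⊗ a - a ⊗ 1` from `A / B` to `A ⊗_B A`. -/
def quotComm : quotBimod B ⟶ (res B).obj ((ind B).obj (regular k B)) :=
  have := (shortExact_inclShortComplex B).epi_g
  (shortExact_inclShortComplex B).exact.desc
    ((commutesWith_indGen k B).mulLeft - (commutesWith_indGen k B).mulRight) <|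
      regular_hom_ext <| sub_eq_zero.2 (commutesWith_indGen k B 1).symm

variable (k B) in
theorem quotProj_quotComm : quotProj k B ≫ quotComm k B =
    (commutesWith_indGen k B).mulLeft - (commutesWith_indGen k B).mulRight :=
  have := (shortExact_inclShortComplex B).epi_g
  (shortExact_inclShortComplex B).exact.g_desc ..

variable (k B) in
theorem quotComm_indMul : quotComm k B ≫ (res B).map (indMul k B) = 0 := by
  rw [← cancel_epi (quotProj k B), ← Category.assoc, quotProj_quotComm, Preadditive.sub_comp,
    mulRight_indMul, mulLeft_indMul, sub_self, comp_zero]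

variable (k B) in
/-- The map `a ⊗ x ⊗ a' ↦ a (1 ⊗ x - x ⊗ 1) a'` from `A ⊗_B A / B ⊗_B A` to `A ⊗_B A`. -/
def indQuotComm : (ind B).obj (quotBimod B) ⟶ (ind B).obj (regular k B) :=
  ((indAdj B).homEquiv _ _).symm (quotComm k B)

variable (k B) in
theorem indQuotComm_indMul : indQuotComm k B ≫ indMul k B = 0 := by
  rw [indQuotComm, ← Adjunction.homEquiv_naturality_right_symm, quotComm_indMul,
    Adjunction.homEquiv_counit, Functor.map_zero, zero_comp]

variable (k B) in
/-- The map `a ↦ 1 ⊗ a ⊗ 1` from `A` to `A ⊗_B A / B ⊗_B A`. -/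
def indQuotMk : A →ₗ[k] (ind B).obj (quotBimod B) :=
  let f := (quotProj k B ≫ (indAdj B).unit.app (quotBimod B)).hom
  { toFun := fun a => f (regular.of (A := A) k a)
    map_add' := map_add f
    map_smul' := fun c a => by
      have h : regular.of k (c • a) = act k (algebraMap k A c) 1 (regular.of k a) := by
        rw [regular_act, mul_one, Algebra.smul_def]
      refine (congrArg f h).trans ((map_smul f (algebraMap k B c ⊗ₜ[k] op 1 : Env k B) _).trans ?_)
      exact algebraMap_smul (M := (ind B).obj (quotBimod B)) (Env k A) c
        (f (regular.of (A := A) k a)) }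

variable (k B) in
theorem indQuotMk_mul (b b' : B) (a : A) :
    indQuotMk k B (b * a * b') = act k (b : A) (b' : A) (indQuotMk k B a) :=
  let f := (quotProj k B ≫ (indAdj B).unit.app (quotBimod B)).hom
  (congrArg f (regular_act k (b : A) (b' : A) a).symm).trans
    (map_smul f (b ⊗ₜ[k] op b' : Env k B) _)

variable (k B) in
theorem indQuotComm_indQuotMk (a : A) : (indQuotComm k B).hom (indQuotMk k B a) =
    act k 1 a (indGen k B) - act k a 1 (indGen k B) := by
  have h : (quotProj k B ≫ (indAdj B).unit.app (quotBimod B)) ≫ (res B).map (indQuotComm k B) =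
      (commutesWith_indGen k B).mulLeft - (commutesWith_indGen k B).mulRight := by
    rw [Category.assoc, ← Adjunction.homEquiv_unit, indQuotComm, Equiv.apply_symm_apply,
      quotProj_quotComm]
  exact congrArg (fun f => f.hom (regular.of k (A := A) a)) h

variable (k B) in
theorem exists_ind_regular_hom_indQuot : ∃ q : (res B).obj ((ind B).obj (regular k B)) ⟶
    (res B).obj ((ind B).obj (quotBimod B)), ∀ a a' : A,
      q.hom (act k a a' (indGen k B) : (ind B).obj (regular k B)) =
        act k a 1 (indQuotMk k B a') := by
  obtain ⟨q, hq⟩ := exists_ind_regular_map (indQuotMk k B) fun b a => by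
    simpa using indQuotMk_mul k B b 1 a
  refine ⟨bimoduleHom (X := (res B).obj ((ind B).obj (regular k B)))
    (Y := (res B).obj ((ind B).obj (quotBimod B))) q fun b b' x => ?_, hq⟩
  let r : Env k A := (b : A) ⊗ₜ op (b' : A)
  refine DFunLike.congr_fun (ind_regular_addHom_ext (f := q.comp (DistribSMul.toAddMonoidHom _ r))
    (g := (DistribSMul.toAddMonoidHom _ r).comp q) fun a a' => ?_) x
  have hr : indQuotMk k B (a' * b') = act k 1 (b' : A) (indQuotMk k B a') := by
    simpa using indQuotMk_mul k B 1 b' a'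
  change q (act k (b : A) (b' : A) (act k a a' _)) = act k (b : A) (b' : A) (q (act k a a' _))
  rw [act_act, hq, hq, hr, act_act, act_act, mul_one, mul_one, one_mul]

variable (k B) in
theorem exists_comp_indQuotComm : ∃ q : (res B).obj ((ind B).obj (regular k B)) ⟶
    (res B).obj ((ind B).obj (quotBimod B)), q ≫ (res B).map (indQuotComm k B) =
      𝟙 _ - (res B).map (indMul k B) ≫ (commutesWith_indGen k B).mulRight := by
  obtain ⟨q, hq⟩ := exists_ind_regular_hom_indQuot k B
  refine ⟨q, ModuleCat.hom_ext (LinearMap.toAddMonoidHom_injective ?_)⟩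
  let γ := indGen k B
  let f : (ind B).obj (regular k B) →+ (ind B).obj (regular k B) :=
    (q ≫ (res B).map (indQuotComm k B)).hom.toAddMonoidHom
  let ρ : A → (ind B).obj (regular k B) := (commutesWith_indGen k B).mulRight.hom
  refine ind_regular_addHom_ext (f := f) fun a a' => ?_
  calc (indQuotComm k B).hom (q.hom (act k a a' γ : (ind B).obj (regular k B)))
      = (indQuotComm k B).hom (act k a 1 (indQuotMk k B a')) := congrArg _ (hq a a')
    _ = act k a 1 (act k 1 a' γ - act k a' 1 γ) :=
        (map_smul (indQuotComm k B).hom _ _).trans (congrArg _ (indQuotComm_indQuotMk k B a'))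
    _ = act k a a' γ - act k (a * a') 1 γ := by
        refine (smul_sub _ _ _).trans ?_
        rw [← act, ← act, act_act, act_act, mul_one, mul_one, mul_one]
    _ = act k a a' γ - ρ ((indMul k B).hom (act k a a' γ)) :=
        congrArg (_ - ρ ·) (indMul_act k B a a').symm

theorem isFlat_res_kernel_indMul (hB : IsFlat k (quotBimod B)) :
    IsFlat k ((res B).obj (kernel (indMul k B))) := by
  obtain ⟨q, hq⟩ := exists_comp_indQuotComm k B
  let ρ := kernel.lift (indMul k B) (indQuotComm k B) (indQuotComm_indMul k B)
  refine IsFlat.of_retract ⟨(res B).map (kernel.ι _) ≫ q, (res B).map ρ, ?_⟩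
    (isFlat_res hB (isFlat_ind hB))
  rw [← cancel_mono ((res B).map (kernel.ι (indMul k B))), Category.assoc, Category.assoc,
    ← Functor.map_comp, kernel.lift_ι, hq, Preadditive.comp_sub, ← Functor.map_comp_assoc,
    kernel.condition, Functor.map_zero, zero_comp, sub_zero, Category.comp_id, Category.id_comp]

end IndRegularKernel

section FreeBimodules

variable {k : Type u} [Field k] {A : Type u} [Ring A] [Algebra k A] {M N Y : Bimodule k A}
  {V W : Type u} [AddCommGroup V] [Module k V] [AddCommGroup W] [Module k W]

variable (M Y) in
/-- The space of maps of right modules between two bimodules. -/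
def rightHom : Submodule k (M →ₗ[k] Y) where
  carrier := {f | ∀ b m, f (act k 1 b m) = act k 1 b (f m)}
  add_mem' {f g} hf hg b m := by
    rw [LinearMap.add_apply, LinearMap.add_apply, hf, hg, act, act, act, smul_add]
  zero_mem' b _ := (smul_zero _).symm
  smul_mem' c f hf b m := by
    rw [LinearMap.smul_apply, LinearMap.smul_apply, hf]
    exact smul_comm _ _ _

/-- The image of a basis of `V` under `ρ` is a basis of the right module `M`. -/
def IsRightFreeOn (ρ : V →ₗ[k] M) : Prop :=
  ∀ Y : Bimodule k A, Function.Bijective (LinearMap.lcomp k Y ρ ∘ₗ (rightHom M Y).subtype)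

/-- The image of a basis of `V` under `γ` is a basis of the bimodule `M`. -/
def IsFreeOn (γ : V →ₗ[k] M) : Prop :=
  ∀ Y : Bimodule k A, Function.Bijective fun f : M ⟶ Y => f.hom.restrictScalars k ∘ₗ γ

variable (M) in
/-- The bimodule `step k M` as the vector space `A ⊗ M`. -/
def stepEquiv : A ⊗[k] M ≃ₗ[k] step k M :=
  { AddEquiv.refl (A ⊗[k] M) with map_smul' := fun c z => (step_smul_k k c z).symm }

variable (k A) in
/-- The bimodule `A` as the vector space `A`. -/
def regularEquiv : A ≃ₗ[k] regular k A :=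
  { AddEquiv.refl A with
    map_smul' := fun c a => by
      refine .symm <| (algebraMap_smul (Env k A) c (regular.of k a)).symm.trans <|
        (regular_act k (algebraMap k A c) 1 a).trans ?_
      rw [mul_one, ← Algebra.smul_def]
      rfl }

theorem isRightFreeOn_regular :
    IsRightFreeOn (LinearMap.toSpanSingleton k (regular k A) (regular.of k 1)) := by
  have act_one (a : A) : act k 1 a (regular.of k 1) = regular.of k a := by
    rw [regular_act, one_mul, one_mul]
  refine fun Y => ⟨fun f g h => Subtype.ext (LinearMap.ext fun (a : A) => ?_), fun f => ?_⟩
  · have h1 : f.1 (regular.of k 1) = g.1 (regular.of k 1) := by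
      simpa using LinearMap.congr_fun h (1 : k)
    refine (congrArg f.1 (act_one a)).symm.trans (.trans ?_ (congrArg g.1 (act_one a)))
    rw [f.2, g.2, h1]
  · let r : A →ₗ[k] Y := (LinearMap.toSpanSingleton (Env k A) Y (f 1)).restrictScalars k ∘ₗ
      Algebra.TensorProduct.includeRight.toLinearMap ∘ₗ (opLinearEquiv k).toLinearMap
    have hr (a : A) : r a = act k 1 a (f 1) := rfl
    refine ⟨⟨r ∘ₗ (regularEquiv k A).symm.toLinearMap, fun b (a : A) => ?_⟩,
      LinearMap.ext_ring ?_⟩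
    · refine (congrArg (r ∘ₗ (regularEquiv k A).symm.toLinearMap) (regular_act k 1 b a)).trans ?_
      change r (1 * a * b) = act k 1 b (r a)
      rw [hr, hr, act_act, one_mul, one_mul]
    · exact (congrArg (r ∘ₗ (regularEquiv k A).symm.toLinearMap)
        (one_smul k (regular.of k (1 : A)))).trans (one_smul (Env k A) (f 1))

theorem IsRightFreeOn.step {ρ : V →ₗ[k] M} (hρ : IsRightFreeOn ρ) :
    IsRightFreeOn (M := step k M) ((stepEquiv M).toLinearMap ∘ₗ ρ.lTensor A) := by
  intro Y
  have mem {f : JZ.step k M →ₗ[k] Y} (hf : f ∈ rightHom (JZ.step k M) Y) (a : A) :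
      f ∘ₗ stepMk k M a ∈ rightHom M Y := fun b m => by
    simpa [act_stepMk] using hf b (stepMk k M a m)
  refine ⟨fun f g h => Subtype.ext ?_, fun f => ?_⟩
  · have hfg (a : A) : f.1 ∘ₗ stepMk k M a = g.1 ∘ₗ stepMk k M a :=
      congrArg Subtype.val <| (hρ Y).1 (a₁ := ⟨_, mem f.2 a⟩) (a₂ := ⟨_, mem g.2 a⟩) <|
        LinearMap.ext fun v => LinearMap.congr_fun h (a ⊗ₜ v)
    have : f.1 ∘ₗ (stepEquiv M).toLinearMap = g.1 ∘ₗ (stepEquiv M).toLinearMap :=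
      TensorProduct.ext' fun a m => LinearMap.congr_fun (hfg a) m
    exact LinearMap.ext fun z => LinearMap.congr_fun this ((stepEquiv M).symm z)
  · let e := LinearEquiv.ofBijective _ (hρ Y)
    let g : A →ₗ[k] M →ₗ[k] Y := (rightHom M Y).subtype ∘ₗ e.symm.toLinearMap ∘ₗ curry f
    refine ⟨⟨TensorProduct.lift g ∘ₗ (stepEquiv M).symm.toLinearMap, fun b z => ?_⟩, ?_⟩
    · refine TensorProduct.induction_on (motive := fun z => TensorProduct.lift g
        (stepAct k M (1 ⊗ₜ[k] op b) z) = act k 1 b (TensorProduct.lift g z)) z ?_ ?_ ?_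
      · simp
      · exact fun a m => (congrArg (g · _) (one_mul a)).trans ((e.symm (curry f a)).2 b m)
      · exact fun y z hy hz => by simp only [map_add, hy, hz, smul_add]
    · refine TensorProduct.ext' fun a v => ?_
      exact LinearMap.congr_fun (e.apply_symm_apply (curry f a)) v

theorem IsRightFreeOn.isFreeOn_step {ρ : V →ₗ[k] M} (hρ : IsRightFreeOn ρ) :
    IsFreeOn (stepMk k M 1 ∘ₗ ρ) := by
  intro Y
  refine ⟨fun f g h => step_hom_ext k fun c m => ?_, fun h => ?_⟩
  · have mem (f : JZ.step k M ⟶ Y) :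
        f.hom.restrictScalars k ∘ₗ stepMk k M 1 ∈ rightHom M Y := fun b m =>
      (congrArg (fun a => f.hom (stepMk k M a (act k 1 b m))) (one_mul 1)).symm.trans
        (map_smul f.hom ((1 : A) ⊗ₜ[k] op b : Env k A) (stepMk k M 1 m))
    have hfg : f.hom (stepMk k M 1 m) = g.hom (stepMk k M 1 m) :=
      LinearMap.congr_fun (congrArg Subtype.val <|
        (hρ Y).1 (a₁ := ⟨_, mem f⟩) (a₂ := ⟨_, mem g⟩) h) m
    have act_mk : act k c 1 (stepMk k M 1 m) = stepMk k M c m := by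
      rw [act_stepMk, mul_one]
      exact congrArg _ (one_smul _ m)
    rw [← act_mk, map_smul, map_smul, hfg]
  · obtain ⟨⟨g, hg⟩, rfl⟩ := (hρ Y).2 h
    refine ⟨stepLift k (((Algebra.lsmul k k Y : Env k A →ₐ[k] Module.End k Y).toLinearMap ∘ₗ
      Algebra.TensorProduct.includeLeft.toLinearMap).compl₂ g) fun a b c m => ?_, ?_⟩
    · change act k (a * c) 1 (g (act k 1 b m)) = act k a b (act k c 1 (g m))
      rw [hg, act_act, act_act, mul_one, one_mul, mul_one]
    · exact LinearMap.ext fun v => one_smul _ (g (ρ v))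

theorem IsFreeOn.projective {γ : V →ₗ[k] M} (hγ : IsFreeOn γ) : Projective M where
  factors {Y Z} f g hg := by
    obtain ⟨s, hs⟩ := (g.hom.restrictScalars k).exists_rightInverse_of_surjective
      (LinearMap.range_eq_top.2 ((ModuleCat.epi_iff_surjective g).1 hg))
    obtain ⟨h, hh⟩ := (hγ Y).2 (s ∘ₗ f.hom.restrictScalars k ∘ₗ γ)
    refine ⟨h, (hγ Z).1 (LinearMap.ext fun v => ?_)⟩
    exact (congrArg g.hom (LinearMap.congr_fun hh v)).trans (LinearMap.congr_fun hs _)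

theorem IsFreeOn.exists_extension {B : Subalgebra k A} {U : Bimodule k B} {γ : V →ₗ[k] U}
    (hγ : IsFreeOn γ) {δ : W →ₗ[k] M} (hδ : IsFreeOn δ) {v : V →ₗ[k] W}
    (hv : Function.Injective v) {j : U ⟶ (res B).obj M} (hj : ∀ x, j.hom (γ x) = δ (v x))
    (f : U ⟶ (res B).obj Y) : ∃ g : M ⟶ Y, j ≫ (res B).map g = f := by
  obtain ⟨r, hr⟩ := v.exists_leftInverse_of_injective (LinearMap.ker_eq_bot.2 hv)
  obtain ⟨g, hg⟩ := (hδ Y).2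
    ((restrictScalarsEquiv (envIncl B) Y).toLinearMap ∘ₗ f.hom.restrictScalars k ∘ₗ γ ∘ₗ r)
  refine ⟨g, (hγ _).1 (LinearMap.ext fun x => ?_)⟩
  refine (congrArg g.hom (hj x)).trans ((LinearMap.congr_fun hg (v x)).trans ?_)
  exact congrArg (f.hom <| γ ·) (LinearMap.congr_fun hr x)

end FreeBimodules

section BarTerms

variable (k : Type u) [Field k] (A : Type u) [Ring A] [Algebra k A]

/-- The vector space `A^{⊗ n}`. -/
def barSpace : ℕ → ModuleCat.{u} k
  | 0 => .of k k
  | n + 1 => .of k (A ⊗[k] barSpace n)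

/-- The map `v ↦ v ⊗ 1` from `A^{⊗ n}` to `A^{⊗ (n+1)}`. -/
def barGen : ∀ n, barSpace k A n →ₗ[k] barTerm k A n
  | 0 => LinearMap.toSpanSingleton k (regular k A) (regular.of k 1)
  | n + 1 => (stepEquiv (barTerm k A n)).toLinearMap ∘ₗ (barGen n).lTensor A

theorem isRightFreeOn_barGen : ∀ n, IsRightFreeOn (barGen k A n)
  | 0 => isRightFreeOn_regular
  | n + 1 => (isRightFreeOn_barGen n).step

theorem projective_barComplex_X (n : ℕ) : Projective ((barComplex k A).X n) :=
  (isRightFreeOn_barGen k A n).isFreeOn_step.projective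

variable {k A} (B : Subalgebra k A)

/-- The inclusion `B^{⊗ n} → A^{⊗ n}`. -/
def barSpaceIncl : ∀ n, barSpace k B n →ₗ[k] barSpace k A n
  | 0 => LinearMap.id
  | n + 1 => TensorProduct.map B.val.toLinearMap (barSpaceIncl n)

theorem barSpaceIncl_injective : ∀ n, Function.Injective (barSpaceIncl B n)
  | 0 => Function.injective_id
  | n + 1 => TensorProduct.map_injective_of_flat_flat _ _ Subtype.val_injective
      (barSpaceIncl_injective n)

theorem barIncl_comp_barGen : ∀ n, (barIncl B n).hom.restrictScalars k ∘ₗ barGen k B n =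
    (restrictScalarsEquiv (envIncl B) (barTerm k A n)).toLinearMap ∘ₗ
      barGen k A n ∘ₗ barSpaceIncl B n
  | 0 => LinearMap.ext_ring <| (congrArg (inclBimod B).hom (one_smul k _)).trans
      (one_smul k (regular.of k (1 : A))).symm
  | n + 1 => TensorProduct.ext' fun b v => congrArg (stepMk k (barTerm k A n) b)
      (LinearMap.congr_fun (barIncl_comp_barGen n) v)

theorem exists_extension_barTerm (n : ℕ) {Y : Bimodule k A}
    (f : barTerm k B (n + 1) ⟶ (res B).obj Y) :
    ∃ g : barTerm k A (n + 1) ⟶ Y, barIncl B (n + 1) ≫ (res B).map g = f :=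
  (isRightFreeOn_barGen k B n).isFreeOn_step.exists_extension
    (isRightFreeOn_barGen k A n).isFreeOn_step (barSpaceIncl_injective B n)
    (fun v => congrArg (stepMk k (barTerm k A n) 1)
      (LinearMap.congr_fun (barIncl_comp_barGen B n) v)) f

end BarTerms

section Exactness

universe v w

theorem quasiIso_toSingle₀_of_homExact {V : Type w} [Category.{v} V] [Abelian V]
    [EnoughProjectives V] {C : ChainComplex V ℕ} {Y : V} (ε : C.X 0 ⟶ Y) (hε : C.d 1 0 ≫ ε = 0)
    (h : ∀ (T : V) [Projective T], HomExact T C ε) :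
    QuasiIso ((C.toSingle₀Equiv Y).symm ⟨ε, hε⟩) := by
  have : Epi ε := by
    obtain ⟨g, hg⟩ := (h (Projective.over Y)).lift_aug (Projective.π Y)
    exact epi_of_epi_fac hg
  refine quasiIso_toSingle₀ ε hε ?_ fun n => ?_
  · refine (ShortComplex.exact_iff_exact_up_to_refinements _).2 fun T x hx => ?_
    obtain ⟨g, hg⟩ := (h (Projective.over T)).lift_zero (Projective.π T ≫ x)
      ((Category.assoc ..).trans <| (congrArg _ hx).trans comp_zero)
    exact ⟨_, Projective.π T, inferInstance, g, hg.symm⟩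
  · rw [exactAt_iff' _ (n + 2) (n + 1) n (by simp) (by simp)]
    refine (ShortComplex.exact_iff_exact_up_to_refinements _).2 fun T x hx => ?_
    obtain ⟨g, hg⟩ := (h (Projective.over T)).lift_succ n (Projective.π T ≫ x)
      ((Category.assoc ..).trans <| (congrArg _ hx).trans comp_zero)
    exact ⟨_, Projective.π T, inferInstance, g, hg.symm⟩

variable (k : Type u) [Field k] (A : Type u) [Ring A] [Algebra k A]

variable {A} in
theorem nextD_stepMk_one {N : Bimodule k A} (d : step k N ⟶ N) (y : step k N) :
    (nextD k d).hom (stepMk k (step k N) 1 y) = y - stepMk k N 1 (d.hom y) :=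
  congrArg (· - stepMk k N 1 (d.hom y)) (one_smul (Env k A) y)

theorem barAug_condition : (barComplex k A).d 1 0 ≫ barAug k A = 0 := by
  rw [barComplex_d]
  exact barD_comp k A 0

theorem exact_barD (n : ℕ) : (ShortComplex.mk _ _ (barD_comp k A n)).Exact :=
  (ShortComplex.moduleCat_exact_iff _).2 fun y (hy : (barD k A n).hom y = 0) =>
    ⟨stepMk k _ 1 y, (nextD_stepMk_one k (barD k A n) y).trans <| by
      rw [hy, map_zero, sub_zero]⟩

/-- The bar resolution as a map of complexes to `A`. -/
def barToRegular : barComplex k A ⟶ (ChainComplex.single₀ _).obj (regular k A) :=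
  ((barComplex k A).toSingle₀Equiv _).symm ⟨barAug k A, barAug_condition k A⟩

instance : QuasiIso (barToRegular k A) := by
  have : Epi (barAug k A) := (ModuleCat.epi_iff_surjective _).2 fun a =>
    ⟨stepMk k (regular k A) 1 a, one_smul (Env k A) a⟩
  refine quasiIso_toSingle₀ _ _ ?_ fun n => ?_
  · exact exact_barD k A 0
  · rw [exactAt_iff' _ (n + 2) (n + 1) n (by simp) (by simp)]
    simp only [sc', shortComplexFunctor', barComplex_d]
    exact exact_barD k A (n + 1)

end Exactness

section DegreewiseSplit

universe v w

variable {V : Type w} [Category.{v} V] [Abelian V] {ι : Type*} {c : ComplexShape ι}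
  {K L : HomologicalComplex V c}

/-- The sequence `K → L → coker f` of complexes. -/
def cokernelSequence (f : K ⟶ L) : ShortComplex (HomologicalComplex V c) :=
  .mk f (cokernel.π f) (cokernel.condition f)

variable {f : K ⟶ L} {r : ∀ i, L.X i ⟶ K.X i}

/-- A degreewise retraction of `f` splits `K → L → coker f` in each degree. -/
def cokernelSplitting (hr : ∀ i, f.f i ≫ r i = 𝟙 _) (i : ι) :
    ((cokernelSequence f).map (eval V c i)).Splitting :=
  .ofExactOfRetraction _
    (((cokernelSequence f).exact_of_g_is_cokernel (cokernelIsCokernel f)).map (eval V c i)) (r i)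
    (hr i) (inferInstanceAs (Epi ((eval V c i).map (cokernel.π f))))

theorem shortExact_map_cokernelSequence {W : Type*} [Category W] [Abelian W] (F : V ⥤ W)
    [F.Additive] (hr : ∀ i, f.f i ≫ r i = 𝟙 _) :
    ((cokernelSequence f).map (F.mapHomologicalComplex c)).ShortExact :=
  shortExact_of_degreewise_shortExact _ fun i => ((cokernelSplitting hr i).map F).shortExact

theorem shortExact_cokernelSequence (hr : ∀ i, f.f i ≫ r i = 𝟙 _) :
    (cokernelSequence f).ShortExact :=
  shortExact_of_degreewise_shortExact _ fun i => (cokernelSplitting hr i).shortExact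

/-- The terms of `coker f` are retracts of the terms of `L` if `f` has a degreewise retraction. -/
def retractCokernel (hr : ∀ i, f.f i ≫ r i = 𝟙 _) (i : ι) :
    Retract ((cokernel f).X i) (L.X i) :=
  ⟨(cokernelSplitting hr i).s, (cokernel.π f).f i, (cokernelSplitting hr i).s_g⟩

variable {K' L' : HomologicalComplex V c} {f' : K' ⟶ L'} {r' : ∀ i, L'.X i ⟶ K'.X i}

theorem quasiIso_cokernel_map (hr : ∀ i, f.f i ≫ r i = 𝟙 _) (hr' : ∀ i, f'.f i ≫ r' i = 𝟙 _)
    (p : K ⟶ K') (q : L ⟶ L') (w : f ≫ q = p ≫ f') [QuasiIso p] [QuasiIso q] :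
    QuasiIso (cokernel.map f f' p q w) :=
  HomologySequence.quasiIso_τ₃
    (ShortComplex.Hom.mk (S₁ := cokernelSequence f) (S₂ := cokernelSequence f') p q
      (cokernel.map f f' p q w) w.symm (cokernel.π_desc _ _ _).symm)
    (shortExact_cokernelSequence hr) (shortExact_cokernelSequence hr') ‹_› ‹_›

end DegreewiseSplit

section Induction

variable {k : Type u} [Field k] {A : Type u} [Ring A] [Algebra k A] (B : Subalgebra k A)

/-- The complex induced from the bar resolution of `B`, with `A ⊗ B^{⊗ n} ⊗ A` in degree `n`. -/
def indBar : ChainComplex (Bimodule k A) ℕ :=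
  ((ind B).mapHomologicalComplex _).obj (barComplex k B)

/-- The chain map `A ⊗ B^{⊗ n} ⊗ A → A ⊗ A^{⊗ n} ⊗ A` adjoint to the inclusion of the bar
resolution of `B`. -/
def indBarIncl : indBar B ⟶ barComplex k A where
  f n := ((indAdj B).homEquiv _ _).symm (barIncl B (n + 1))
  comm' i j hij := by
    obtain rfl : j + 1 = i := hij
    refine ((indAdj B).homEquiv_naturality_right_symm _ _).symm.trans <|
      .trans (congrArg _ ?_) ((indAdj B).homEquiv_naturality_left_symm _ _)
    rw [barComplex_d, barComplex_d]
    exact barIncl_comm B (j + 1)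

theorem exists_retraction_indBarIncl :
    ∃ r : ∀ n, (barComplex k A).X n ⟶ (indBar B).X n, ∀ n, (indBarIncl B).f n ≫ r n = 𝟙 _ := by
  choose r hr using fun n =>
    exists_extension_barTerm B n ((indAdj B).unit.app (barTerm k B (n + 1)))
  refine ⟨r, fun n => ((indAdj B).homEquiv _ _).injective ?_⟩
  refine ((indAdj B).homEquiv_naturality_right _ _).trans <|
    (congrArg (· ≫ (res B).map (r n)) (Equiv.apply_symm_apply _ _)).trans ?_
  exact (hr n).trans ((indAdj B).homEquiv_id _).symm

/-- The augmentation of the induced bar resolution. -/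
def indBarAug : indBar B ⟶ (ChainComplex.single₀ _).obj ((ind B).obj (regular k B)) :=
  ((ind B).mapHomologicalComplex _).map (barToRegular k B) ≫
    ((singleMapHomologicalComplex (ind B) (.down ℕ) 0).app (regular k B)).hom

theorem indBarAug_f_zero : (indBarAug B).f 0 = (ind B).map (barAug k B) := by
  refine (congrArg₂ (· ≫ ·) (congrArg (ind B).map
    ((barComplex k B).toSingle₀Equiv_symm_apply_f_zero (barAug k B) (barAug_condition k B)))
    (singleMapHomologicalComplex_hom_app_self (ind B) (.down ℕ) 0 _)).trans ?_
  have h : (ind B).map (𝟙 (regular k B)) ≫ 𝟙 _ = 𝟙 _ := by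
    rw [Category.comp_id, CategoryTheory.Functor.map_id]
  exact (congrArg _ h).trans (Category.comp_id _)

theorem quasiIso_indBarAug (hB : IsFlat k (quotBimod B)) : QuasiIso (indBarAug B) := by
  have := preservesHomology_ind hB
  have : QuasiIso (((ind B).mapHomologicalComplex (.down ℕ)).map (barToRegular k B)) :=
    quasiIso_map_of_preservesHomology (barToRegular k B) (ind B)
  exact (quasiIso_iff_comp_right _ _).2 this

end Induction

section BaseChange

variable {k : Type u} [Field k] {A : Type u} [Ring A] [Algebra k A] (B : Subalgebra k A)
  (X : Bimodule k A)

theorem map_comp_tensorRes {U : Bimodule k B} {Q R : Bimodule k A} (g : U ⟶ (res B).obj Q)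
    (f : Q ⟶ R) :
    BTensor.map k (𝟙 X) f ∘ₗ tensorRes B X g = tensorRes B X (g ≫ (res B).map f) :=
  BTensor.hom_ext k fun _ _ => rfl

theorem tensorRes_comp_map {U V : Bimodule k B} {Q : Bimodule k A} (f : U ⟶ V)
    (g : V ⟶ (res B).obj Q) :
    tensorRes B X g ∘ₗ BTensor.map k (𝟙 _) f = tensorRes B X (f ≫ g) :=
  BTensor.hom_ext k fun _ _ => rfl

/-- The natural map `X ⊗_{Bᵉ} U → X ⊗_{Aᵉ} (A ⊗_B U ⊗_B A)`. -/
def tensorResToInd : tensorFunctor k ((res B).obj X) ⟶ ind B ⋙ tensorFunctor k X where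
  app U := ModuleCat.ofHom (tensorRes B X ((indAdj B).unit.app U))
  naturality _ _ f := ModuleCat.hom_ext <| (tensorRes_comp_map B X f _).trans <|
    (congrArg (tensorRes B X) ((indAdj B).unit.naturality f)).trans
      (map_comp_tensorRes B X _ _).symm

instance : IsIso (tensorResToInd B X) := by
  have (U : Bimodule k B) : IsIso ((tensorResToInd B X).app U) := by
    refine isIso_of_coyoneda_map_bijective _ fun W => ?_
    let e : ((tensorFunctor k X).obj ((ind B).obj U) ⟶ W) ≃
        ((tensorFunctor k ((res B).obj X)).obj U ⟶ W) :=
      ModuleCat.homEquiv.trans <| (tensorHomEquiv X _ W).trans <|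
        ((indAdj B).homEquiv U (dual k X W)).trans <|
          ((Iso.refl U).homCongr (dualResIso B X W).symm).trans <|
            (tensorHomEquiv ((res B).obj X) U W).symm.trans
              (ModuleCat.homEquiv (M := (tensorFunctor k ((res B).obj X)).obj U)).symm
    have he (f) : (tensorResToInd B X).app U ≫ f = e f := by
      let f' : (ind B).obj U ⟶ dual k X W := tensorHomEquiv X _ W f.hom
      refine ModuleCat.hom_ext <| BTensor.hom_ext k fun x u => ?_
      exact (congrArg (fun g : U ⟶ (res B).obj (dual k X W) =>
        dual.equiv (show dual k X W from g.hom u) x) ((indAdj B).homEquiv_unit (f := f')).symm :)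
    exact ⟨fun f g h => e.injective <| (he f).symm.trans (h.trans (he g)),
      fun g => ⟨e.symm g, (he _).trans (e.apply_symm_apply g)⟩⟩
  exact NatIso.isIso_of_isIso_app _

/-- The isomorphism `C_*(B, X) ≅ X ⊗_{Aᵉ} Ind Bar(B)`. -/
def hochschildComplexResIso :
    hochschildComplex k ((res B).obj X) ≅ (tensorComplex k X).obj (indBar B) :=
  (NatIso.mapHomologicalComplex (asIso (tensorResToInd B X)) _).app (barComplex k B)

theorem hochschildComplexResIso_hom_comp :
    (hochschildComplexResIso B X).hom ≫ (tensorComplex k X).map (indBarIncl B) =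
      inclComplex B X := by
  ext n : 1
  refine ModuleCat.hom_ext <| (map_comp_tensorRes B X _ _).trans ?_
  exact congrArg (tensorRes B X) <| ((indAdj B).homEquiv_unit ..).symm.trans <|
    Equiv.apply_symm_apply _ _

end BaseChange

section RelativeResolutions

variable {k : Type u} [Field k] {A : Type u} [Ring A] [Algebra k A] {B : Subalgebra k A}
  {Y : Bimodule k A}

theorem isRelProjective_of_projective (P : Bimodule k A) [Projective P] : IsRelProjective B P :=
  fun _ _ g s hs f =>
    have : Epi ((res B).map g) := SplitEpi.epi ⟨s, hs⟩
    have : Epi g := (res B).epi_of_epi_map this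
    ⟨Projective.factorThru f g, Projective.factorThru_comp f g⟩

theorem isRelProjective_barComplex_X (n : ℕ) : IsRelProjective B ((barComplex k A).X n) :=
  have := projective_barComplex_X k A n
  isRelProjective_of_projective _

namespace RelResolution

theorem exists_isComparison (P : RelResolution B (regular k A)) :
    ∃ φ : barComplex k A ⟶ P.complex, P.IsComparison φ :=
  exists_hom_of_homExact (fun n => P.homExact (isRelProjective_barComplex_X n)) _
    (barAug_condition k A)

theorem exists_homotopyEquiv (P Q : RelResolution B Y) :
    ∃ e : HomotopyEquiv P.complex Q.complex, e.hom.f 0 ≫ Q.aug = P.aug := by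
  obtain ⟨f, hf⟩ := exists_hom_of_homExact (fun n => Q.homExact (P.relProjective n)) _ P.d_comp_aug
  obtain ⟨g, hg⟩ := exists_hom_of_homExact (fun n => P.homExact (Q.relProjective n)) _ Q.d_comp_aug
  obtain ⟨H⟩ := homotopy_of_homExact (fun n => P.homExact (P.relProjective n)) (φ := f ≫ g)
    (ψ := 𝟙 _) (by rw [comp_f, Category.assoc, hg, hf, id_f, Category.id_comp])
  obtain ⟨H'⟩ := homotopy_of_homExact (fun n => Q.homExact (Q.relProjective n)) (φ := g ≫ f)
    (ψ := 𝟙 _) (by rw [comp_f, Category.assoc, hf, hg, id_f, Category.id_comp])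
  exact ⟨⟨f, g, H, H'⟩, hf⟩

theorem IsComparison.quasiIso {P : RelResolution B (regular k A)} {φ : barComplex k A ⟶ P.complex}
    (hφ : P.IsComparison φ) : QuasiIso φ := by
  have h := quasiIso_toSingle₀_of_homExact P.aug P.d_comp_aug fun T _ =>
    P.homExact (isRelProjective_of_projective T)
  refine @quasiIso_of_comp_right _ _ _ _ _ _ _ _ φ _ _ _ _ h ?_
  convert (inferInstance : QuasiIso (barToRegular k A))
  exact to_single_hom_ext hφ

end RelResolution

end RelativeResolutions

section MulResolution

variable {k : Type u} [Field k] {A : Type u} [Ring A] [Algebra k A] (B : Subalgebra k A)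

/-- The relative resolution of `A` starting with the multiplication `A ⊗_B A → A`. -/
def mulResolution : RelResolution B (regular k A) :=
  relResolution (indMul k B) (isRelProjective_ind _) ⟨_, mulRight_indMul k B⟩

/-- The inclusion of the term `A ⊗_B A` in degree `0`. -/
def mulResolutionIncl : (ChainComplex.single₀ _).obj ((ind B).obj (regular k B)) ⟶
    (mulResolution B).complex :=
  ((mulResolution B).complex.fromSingle₀Equiv ((ind B).obj (regular k B))).symm (𝟙 _)

theorem exists_retraction_mulResolutionIncl : ∃ r : ∀ n, (mulResolution B).complex.X n ⟶
    ((ChainComplex.single₀ _).obj ((ind B).obj (regular k B))).X n,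
    ∀ n, (mulResolutionIncl B).f n ≫ r n = 𝟙 _ :=
  ⟨fun | 0 => 𝟙 ((ind B).obj (regular k B)) | _ + 1 => 0, fun
    | 0 => Category.comp_id (𝟙 ((ind B).obj (regular k B)))
    | n + 1 => (isZero_single_obj_X _ _ _ _ n.succ_ne_zero).eq_of_src _ _⟩

theorem isFlat_cokernel_mulResolutionIncl_X (hB : IsFlat k (quotBimod B)) (n : ℕ) :
    IsFlat k ((cokernel (mulResolutionIncl B)).X n) := by
  obtain ⟨r, hr⟩ := exists_retraction_mulResolutionIncl B
  cases n with
  | zero =>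
    have h : 𝟙 ((ind B).obj (regular k B)) ≫ (cokernel.π (mulResolutionIncl B)).f 0 = 0 :=
      congrArg (fun f => f.f 0) (cokernel.condition (mulResolutionIncl B))
    have := ((IsZero.iff_id_eq_zero _).2 <| (retractCokernel hr 0).retract.symm.trans <|
      (congrArg _ ((Category.id_comp _).symm.trans h)).trans comp_zero).projective
    exact isFlat_of_projective _
  | succ n =>
    exact IsFlat.of_retract (retractCokernel hr (n + 1))
      (isFlat_relTerm_succ hB (isFlat_res_kernel_indMul hB) n)

theorem isFlat_cokernel_indBarIncl_X (n : ℕ) : IsFlat k ((cokernel (indBarIncl B)).X n) := by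
  obtain ⟨r, hr⟩ := exists_retraction_indBarIncl B
  have := projective_barComplex_X k A n
  exact IsFlat.of_retract (retractCokernel hr n) (isFlat_of_projective _)

theorem indBarIncl_f_zero_barAug :
    (indBarIncl B).f 0 ≫ barAug k A = (ind B).map (barAug k B) ≫ indMul k B :=
  ((indAdj B).homEquiv_naturality_right_symm _ _).symm.trans <|
    (congrArg _ (barIncl_comm B 0)).trans ((indAdj B).homEquiv_naturality_left_symm _ _)

theorem exists_comparison_mulResolution : ∃ φ : barComplex k A ⟶ (mulResolution B).complex,
    (mulResolution B).IsComparison φ ∧ indBarIncl B ≫ φ = indBarAug B ≫ mulResolutionIncl B := by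
  obtain ⟨φ, hφ⟩ := (mulResolution B).exists_isComparison
  obtain ⟨r, hr⟩ := exists_retraction_indBarIncl B
  obtain ⟨H⟩ := homotopy_of_homExact (φ := indBarIncl B ≫ φ)
    (ψ := indBarAug B ≫ mulResolutionIncl B)
    (fun n => (mulResolution B).homExact (isRelProjective_ind _)) <| by
      have h : (mulResolutionIncl B).f 0 ≫ (mulResolution B).aug = indMul k B := Category.id_comp _
      rw [comp_f, comp_f, Category.assoc, Category.assoc, h, indBarAug_f_zero]
      exact (congrArg _ hφ).trans (indBarIncl_f_zero_barAug B)
  obtain ⟨φ', ⟨H'⟩, h⟩ := exists_homotopic_comp_eq hr H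
  exact ⟨φ', (comp_eq_comp_of_homotopy H' (mulResolution B).d_comp_aug).symm.trans hφ, h⟩

end MulResolution

section JacobiZariski

variable {k : Type u} [Field k] {A : Type u} [Ring A] [Algebra k A] {B : Subalgebra k A}

variable (B) in
/-- The sequence of complexes `C_*(B, X) → C_*(A, X) → X ⊗_{Aᵉ} coker(Ind Bar(B) → Bar(A))`. -/
def inclSequence (X : Bimodule k A) : ShortComplex (ChainComplex (ModuleCat.{u} k) ℕ) :=
  .mk (X₂ := (tensorComplex k X).obj (barComplex k A)) (inclComplex B X)
    ((tensorComplex k X).map (cokernel.π (indBarIncl B))) <|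
    (congrArg (· ≫ _) (hochschildComplexResIso_hom_comp B X).symm).trans <|
      (Category.assoc _ _ _).trans <|
        (congrArg _ ((cokernelSequence (indBarIncl B)).map (tensorComplex k X)).zero).trans
          comp_zero

variable (B) in
theorem shortExact_inclSequence (X : Bimodule k A) : (inclSequence B X).ShortExact := by
  obtain ⟨r, hr⟩ := exists_retraction_indBarIncl B
  refine ShortComplex.shortExact_of_iso (ShortComplex.isoMk
    (S₁ := (cokernelSequence (indBarIncl B)).map (tensorComplex k X)) (S₂ := inclSequence B X)
    (hochschildComplexResIso B X).symm (Iso.refl _) (Iso.refl _) ?_ ?_)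
    (shortExact_map_cokernelSequence (tensorFunctor k X) hr)
  · exact ((hochschildComplexResIso B X).inv_comp_eq.2
      (hochschildComplexResIso_hom_comp B X).symm).trans (Category.comp_id _).symm
  · exact (Category.id_comp _).trans (Category.comp_id _).symm

theorem exists_connecting_mulResolution (hB : IsFlat k (quotBimod B)) (X : Bimodule k A) :
    ∃ φ : barComplex k A ⟶ (mulResolution B).complex, (mulResolution B).IsComparison φ ∧
      ∃ δ : ∀ m, (mulResolution B).relTor X (m + 1) ⟶ HH k ((res B).obj X) m, ∀ m, 1 ≤ m →
        Function.Exact (mapI B X m).hom (mapK φ X m).hom ∧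
        Function.Exact (mapK φ X (m + 1)).hom (δ m).hom ∧
        Function.Exact (δ m).hom (mapI B X m).hom := by
  obtain ⟨φ, hφ, h⟩ := exists_comparison_mulResolution B
  obtain ⟨r, hr⟩ := exists_retraction_indBarIncl B
  obtain ⟨r', hr'⟩ := exists_retraction_mulResolutionIncl B
  have := quasiIso_indBarAug B hB
  have := hφ.quasiIso
  have := quasiIso_cokernel_map hr hr' (indBarAug B) φ h
  have hψ := quasiIso_tensorComplex_map (isFlat_cokernel_indBarIncl_X B)
    (isFlat_cokernel_mulResolutionIncl_X B hB) (cokernel.map _ _ _ _ h) X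
  refine ⟨φ, hφ, exists_connecting_of_shortExact (shortExact_inclSequence B X)
    (shortExact_map_cokernelSequence (tensorFunctor k X) hr') ((tensorComplex k X).map φ) _ hψ ?_
    fun n => ?_⟩
  · exact ((tensorComplex k X).map_comp _ _).symm.trans <|
      (congrArg (tensorComplex k X).map (cokernel.π_desc _ _ _)).trans <|
        (tensorComplex k X).map_comp _ _
  · have h₀ : IsZero (((ChainComplex.single₀ (Bimodule k A)).obj
        ((ind B).obj (regular k B))).X (n + 1)) := isZero_single_obj_X _ _ _ _ n.succ_ne_zero
    exact ShortComplex.exact_of_isZero_X₂ _ ((tensorFunctor k X).map_isZero h₀)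

theorem exists_connecting (hB : IsFlat k (quotBimod B)) {P : RelResolution B (regular k A)}
    {φ : barComplex k A ⟶ P.complex} (hφ : P.IsComparison φ) (X : Bimodule k A) :
    ∃ δ : ∀ m, P.relTor X (m + 1) ⟶ HH k ((res B).obj X) m, ∀ m, 1 ≤ m →
      Function.Exact (mapI B X m).hom (mapK φ X m).hom ∧
      Function.Exact (mapK φ X (m + 1)).hom (δ m).hom ∧
      Function.Exact (δ m).hom (mapI B X m).hom := by
  obtain ⟨ψ, hψ, δ, h⟩ := exists_connecting_mulResolution hB X
  obtain ⟨e, he⟩ := (mulResolution B).exists_homotopyEquiv P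
  let i (m : ℕ) : (mulResolution B).relTor X m ≅ P.relTor X m :=
    ((tensorFunctor k X).mapHomotopyEquiv e).toHomologyIso m
  have hi (m : ℕ) : mapK φ X m = mapK ψ X m ≫ (i m).hom := by
    obtain ⟨H⟩ := homotopy_of_homExact (φ := φ) (ψ := ψ ≫ e.hom)
      (fun n => P.homExact (isRelProjective_barComplex_X n)) <| by
        rw [comp_f, Category.assoc, he, hψ, hφ]
    exact ((tensorFunctor k X).mapHomotopy H).homologyMap_eq m |>.trans <|
      (congrArg (homologyMap · m) (Functor.map_comp _ _ _)).trans (homologyMap_comp _ _ _)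
  refine ⟨fun m => (i (m + 1)).inv ≫ δ m, fun m hm => ?_⟩
  obtain ⟨h₁, h₂, h₃⟩ := h m hm
  rw [hi, hi]
  exact ⟨h₁.comp_injective _ (i m).toLinearEquiv.injective (map_zero (i m).hom.hom),
    (LinearEquiv.conj_exact_iff_exact _ _ (i (m + 1)).toLinearEquiv).2 h₂,
    ((i (m + 1)).symm.toLinearEquiv.surjective.comp_exact_iff_exact).2 h₃⟩

end JacobiZariski

end

end JZ

theorem mainTheorem4_general {k : Type u} [Field k] {A : Type u} [Ring A] [Algebra k A]
    (B : Subalgebra k A) (hflat : IsFlat k (quotBimod B)) (X : Bimodule k A) :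
    Nonempty (RelResolution B (regular k A)) ∧
    ∀ P : RelResolution B (regular k A),
      (∃ φ : barComplex k A ⟶ P.complex, P.IsComparison φ) ∧
      ∀ φ : barComplex k A ⟶ P.complex, P.IsComparison φ →
        ∃ δ : ∀ m : ℕ, P.relTor X (m + 1) ⟶ HH k ((res B).obj X) m,
          ∀ m : ℕ, 1 ≤ m →
            Function.Exact (mapI B X m).hom (mapK φ X m).hom ∧
            Function.Exact (mapK φ X (m + 1)).hom (δ m).hom ∧
            Function.Exact (δ m).hom (mapI B X m).hom :=
  ⟨⟨mulResolution B⟩, fun P =>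
    ⟨P.exists_isComparison, fun _ hφ => exists_connecting hflat hφ X⟩⟩

theorem mainTheorem4 {k : Type u} [Field k] {A : Type u} [Ring A] [Algebra k A]
    (B : Subalgebra k A) (hflat : IsFlat k (quotBimod B)) (X : Bimodule k A) :
    Nonempty (RelResolution B (regular k A)) ∧
    ∀ P : RelResolution B (regular k A),
      (∃ φ : barComplex k A ⟶ P.complex, P.IsComparison φ) ∧
      ∀ φ : barComplex k A ⟶ P.complex, P.IsComparison φ →
        ∃ δ : ∀ m : ℕ, P.relTor X (m + 1) ⟶ HH k ((res B).obj X) m,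
          (∀ m : ℕ, 2 ≤ m →
            Function.Exact (mapI B X m).hom (mapK φ X m).hom ∧
            Function.Exact (mapK φ X (m + 1)).hom (δ m).hom ∧
            Function.Exact (δ m).hom (mapI B X m).hom) ∧
          (Module.Finite k A → Module.Finite k X → ∀ m : ℕ, 1 ≤ m →
            Function.Exact (mapI B X m).hom (mapK φ X m).hom ∧
            Function.Exact (mapK φ X (m + 1)).hom (δ m).hom ∧
            Function.Exact (δ m).hom (mapI B X m).hom) := by
  obtain ⟨hP, h⟩ := mainTheorem4_general B hflat X
  exact ⟨hP, fun P => ⟨(h P).1, fun φ hφ => ((h P).2 φ hφ).imp fun _ key =>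
    ⟨fun m hm => key m (by lia), fun _ _ => key⟩⟩⟩
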